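/- Let $d\ge 1$ be an integer and let $\lambda>0$. Let $\mathcal P$ and $\mathcal P'$ be independent homogeneous Poisson point processes in $\mathbb R^d$ of intensities $1$ and $\lambda$ respectively. Let $G'_{\rm sec}$ be the undirected graph with vertex set $\mathcal P$ in which two distinct points $x,y\in\mathcal P$ are joined by an edge if and only if neither of the open balls $B(x,\|x-y\|)$ and $B(y,\|x-y\|)$ contains a point of $\mathcal P'$. Then the number of infinite connected components of $G'_{\rm sec}$ is either almost surely equal to $0$ or almost surely equal to $1$. -/

import Mathlib

open MeasureTheory ProbabilityTheory
open scoped NNReal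

noncomputable section

namespace SecrecyGraph

/-- Euclidean space of dimension `d`. -/
abbrev Space (d : ℕ) : Type := EuclideanSpace ℝ (Fin d)

/-- Locally finite subsets of `ℝ^d`: the possible realizations of a simple point process. -/
def Config (d : ℕ) : Type :=
  {S : Set (Space d) // ∀ B : Set (Space d), Bornology.IsBounded B → (S ∩ B).Finite}

/-- The set of points of a configuration. -/
def Config.points {d : ℕ} (S : Config d) : Set (Space d) := S.1

/-- The number of points of a configuration in `B` (used for bounded `B`, where it is finite). -/
def Config.count {d : ℕ} (B : Set (Space d)) (S : Config d) : ℕ := (S.points ∩ B).ncard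

/-- The sigma-algebra on configurations generated by the numbers of points in bounded Borel
sets. -/
instance (d : ℕ) : MeasurableSpace (Config d) :=
  ⨆ (B : Set (Space d)) (_ : MeasurableSet B) (_ : Bornology.IsBounded B),
    MeasurableSpace.comap (Config.count B) ⊤

/-- `X` is a homogeneous Poisson point process in `ℝ^d` of intensity `c`: the number of points in
a bounded Borel set `B` is Poisson with mean `c * vol B`, and the numbers of points in finitely many
pairwise disjoint bounded Borel sets are independent. -/
structure IsPoissonProcess {d : ℕ} {Ω : Type*} [MeasurableSpace Ω] (μ : Measure Ω) (c : ℝ≥0)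
    (X : Ω → Config d) : Prop where
  measurable : Measurable X
  law_count : ∀ B : Set (Space d), MeasurableSet B → Bornology.IsBounded B →
    HasLaw (fun ω => (X ω).count B) (poissonMeasure (c * (volume B).toNNReal)) μ
  indep_count : ∀ (n : ℕ) (B : Fin n → Set (Space d)), (∀ i, MeasurableSet (B i)) →
    (∀ i, Bornology.IsBounded (B i)) → Pairwise (fun i j => Disjoint (B i) (B j)) →
    iIndepFun (fun i ω => (X ω).count (B i)) μ

/-- The directed secrecy graph on the black points: there is an edge from `x` to `y ≠ x` when no
red point lies in the open ball centred at `x` with radius `‖x - y‖`. -/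
def directedGraph {d : ℕ} (black red : Config d) : Digraph black.points where
  Adj x y := x ≠ y ∧ ∀ z ∈ red.points, z ∉ Metric.ball (x : Space d) ‖(x : Space d) - y‖

/-- The undirected graph of bidirectional secrecy edges: `x` and `y` are adjacent when both directed
edges are present in the directed secrecy graph. -/
def bidirectionalGraph {d : ℕ} (black red : Config d) : SimpleGraph black.points :=
  (directedGraph black red).toSimpleGraphStrict

/-- The number (possibly infinite) of infinite connected components of a graph. -/
def numInfiniteComponents {V : Type*} (G : SimpleGraph V) : ℕ∞ :=
  {C : G.ConnectedComponent | C.supp.Infinite}.encard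

end SecrecyGraph

end

/-! Call the points of $\mathcal P$ black and those of $\mathcal P'$ red. The argument is of
Burton–Keane type. Shifts by a long vector make local events independent, so under the product law
every translation invariant event has probability zero or one
(`measure_eq_zero_or_one_of_invariant`). In particular, for each k, the existence of k distinct
infinite clusters has probability 0 or 1. It remains to exclude k = 2.

The finite energy property comes from emptying a ball of red points. The red process in the ball is
independent of everything else and is empty there with positive probability
(`measure_pos_of_removal`). Fewer red points means more edges: emptying the ball of radius 3L joins
all black points of the ball of radius L. Edges may be arbitrarily long, so it must also be checked
that only finitely many are added. Almost surely red points lie far out in all directions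
(`ae_surrounds`), and they block the edges that the removed points used to block far away
(`Surrounds.exists_bound_change`).

Suppose two infinite clusters exist almost surely. If three do not, a removal merges the two and
leaves at most one, with positive probability, which is a contradiction. If three do, a removal
creates a trifurcation with positive probability. But trifurcations almost surely do not exist: in a
large box their number is at most twice the number of points with a neighbour outside
(`card_trifurcation_le`). Such points lie in a thin collar or are the centre of a large ball free of
red points, so their expected number is of smaller order than the volume
(`measure_hasTrifurcation_eq_zero`). -/

namespace SecrecyGraph

/-! ### Trifurcations and infinite clusters in an abstract graph -/

section Graph

variable {V : Type*}

/-- The graph `G` with all edges meeting `K` removed. -/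
def deleteVerts (G : SimpleGraph V) (K : Set V) : SimpleGraph V where
  Adj x y := G.Adj x y ∧ x ∉ K ∧ y ∉ K
  symm := ⟨fun _ _ h => ⟨h.1.symm, h.2.2, h.2.1⟩⟩
  loopless := ⟨fun _ h => h.1.ne rfl⟩

/-- The set of vertices reachable from `x`. -/
def cluster (G : SimpleGraph V) (x : V) : Set V := {y | G.Reachable x y}

/-- There are `k` points of `U` lying in distinct infinite clusters of `G`. -/
def HasInfiniteClusters (G : SimpleGraph V) (U : Set V) (k : ℕ) : Prop :=
  ∃ x : Fin k → V, (∀ i, x i ∈ U) ∧ (∀ i, (cluster G (x i)).Infinite) ∧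
    Pairwise fun i j => ¬ G.Reachable (x i) (x j)

/-- The points `k 0, …, k n` form a path whose removal leaves the three infinite branches of the
neighbours `a 0, a 1, a 2` disconnected from each other. -/
structure IsTrifurcation (G : SimpleGraph V) (n : ℕ) (k : Fin (n + 1) → V) (a : Fin 3 → V) :
    Prop where
  chain : ∀ i : Fin n, G.Adj (k i.castSucc) (k i.succ)
  attached : ∀ j, ∃ i, G.Adj (k i) (a j)
  notMem : ∀ j, a j ∉ Set.range k
  infinite : ∀ j, (cluster (deleteVerts G (Set.range k)) (a j)).Infinite
  separated : Pairwise fun i j => ¬ (deleteVerts G (Set.range k)).Reachable (a i) (a j)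

/-- `G` has a trifurcation whose core lies in `U`. -/
def HasTrifurcation (G : SimpleGraph V) (U : Set V) : Prop :=
  ∃ (n : ℕ) (k : Fin (n + 1) → V) (a : Fin 3 → V), (∀ i, k i ∈ U) ∧ IsTrifurcation G n k a

/-- To prove a property of all vertices reachable from `x`, propagate it along edges. -/
lemma reachable_induction {G : SimpleGraph V} {x y : V} (h : G.Reachable x y) (p : V → Prop)
    (h0 : p x) (hs : ∀ u v, G.Reachable x u → p u → G.Adj u v → p v) : p y := by
  rw [SimpleGraph.reachable_iff_reflTransGen] at h
  induction h with
  | refl => exact h0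
  | tail hu hv ih =>
    exact hs _ _ ((SimpleGraph.reachable_iff_reflTransGen _ _).2 hu) ih hv

lemma reachable_of_adj_imp {G G' : SimpleGraph V} {x y : V} (h : G.Reachable x y)
    (hs : ∀ u v, G.Reachable x u → G.Adj u v → G'.Adj u v) : G'.Reachable x y :=
  reachable_induction h (fun y => G'.Reachable x y) (SimpleGraph.Reachable.refl x)
    fun u v hu hxu huv => hxu.trans (hs u v hu huv).reachable

lemma deleteVerts_le (G : SimpleGraph V) (K : Set V) : deleteVerts G K ≤ G := fun _ _ h => h.1

lemma deleteVerts_mono {G G' : SimpleGraph V} (h : G ≤ G') (K : Set V) :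
    deleteVerts G K ≤ deleteVerts G' K := fun _ _ ha => ⟨h ha.1, ha.2⟩

lemma cluster_mono {G G' : SimpleGraph V} (h : G ≤ G') (x : V) : cluster G x ⊆ cluster G' x :=
  fun _ hy => SimpleGraph.Reachable.mono h hy

lemma notMem_of_reachable_deleteVerts {G : SimpleGraph V} {K : Set V} {x y : V} (hx : x ∉ K)
    (h : (deleteVerts G K).Reachable x y) : y ∉ K :=
  reachable_induction h (fun y => y ∉ K) hx fun _ _ _ _ huv => huv.2.2

/-- Branches of a family of pairwise compatible trifurcations are at least as numerous as the
trifurcations, as witnessed by any set of leaves meeting all the branches. -/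
lemma card_le_of_branching {ι : Type*} (K : ι → Set V) (A : ι → Fin 3 → Set V)
    (hne : ∀ z, (K z).Nonempty) (hdisj : ∀ z, Pairwise fun i j => Disjoint (A z i) (A z j))
    (hKA : ∀ z j, Disjoint (K z) (A z j))
    (hone : ∀ z z', z ≠ z' → ∃ j, ∀ j' ≠ j, Disjoint (K z') (A z j'))
    (hcross : ∀ z z' j j', z ≠ z' → Disjoint (K z') (A z j) →
      (A z' j' ∩ (A z j ∪ K z)).Nonempty → A z j ∪ K z ⊆ A z' j')
    (Z : Finset ι) (Y : Finset V) (hY : ∀ z ∈ Z, ∀ j, ∃ y ∈ Y, y ∈ A z j) :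
    Z.card ≤ Y.card := by
  classical
  induction hn : Z.card generalizing Z Y with
  | zero => exact Nat.zero_le _
  | succ m ih =>
    have hZ : Z.Nonempty := Finset.card_pos.1 (by omega)
    -- A branch meeting the fewest cores meets no core other than its own trifurcation's: a further
    -- core inside it would have a branch contained in it that meets strictly fewer cores. Such an
    -- outermost trifurcation is removed together with one leaf of this branch.
    let c : ι × Fin 3 → ℕ := fun p => (Z.filter fun z => ¬ Disjoint (K z) (A p.1 p.2)).card
    obtain ⟨⟨z, j⟩, hzj, hmin⟩ := Finset.exists_min_image (Z ×ˢ (Finset.univ : Finset (Fin 3))) c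
      (hZ.product Finset.univ_nonempty)
    have hz : z ∈ Z := (Finset.mem_product.1 hzj).1
    have hfree : ∀ z' ∈ Z, z' ≠ z → Disjoint (K z') (A z j) := by
      intro z' hz' hne'
      by_contra hnd
      obtain ⟨j0, hj0⟩ := hone z' z hne'
      obtain ⟨j', hj'⟩ := exists_ne j0
      have hsub := hcross z' z j' j hne' (hj0 j' hj') (by
        obtain ⟨w, hw1, hw2⟩ := Set.not_disjoint_iff.1 hnd
        exact ⟨w, hw2, Or.inr hw1⟩)
      have hlt : c (z', j') < c (z, j) := by
        apply Finset.card_lt_card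
        refine Finset.ssubset_iff_subset_ne.2 ⟨?_, ?_⟩
        · intro w hw
          simp only [Finset.mem_filter] at hw ⊢
          exact ⟨hw.1, fun hd => hw.2 (hd.mono_right (Set.subset_union_left.trans hsub))⟩
        · intro heq
          have : z' ∈ Z.filter fun w => ¬ Disjoint (K w) (A z j) :=
            Finset.mem_filter.2 ⟨hz', hnd⟩
          have h2 := heq ▸ this
          exact (Finset.mem_filter.1 h2).2 (hKA z' j')
      exact absurd (hmin (z', j') (by simp [hz'])) (not_le.2 hlt)
    obtain ⟨y, hyY, hyA⟩ := hY z hz j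
    have key := ih (Z.erase z) (Y.erase y) (by
      intro z' hz' j'
      obtain ⟨hne', hz'⟩ := Finset.mem_erase.1 hz'
      obtain ⟨y', hy'Y, hy'A⟩ := hY z' hz' j'
      by_cases hyy : y' = y
      · subst hyy
        have hsub := hcross z z' j j' hne'.symm (hfree z' hz' hne') ⟨y', hy'A, Or.inl hyA⟩
        obtain ⟨j0, hj0⟩ := hone z z' hne'.symm
        -- This is where three branches are needed. If the leaf `y` was the one used by `z'`,
        -- another branch of `z`, neither `j` nor the one towards `z'`, also lies in that branch of
        -- `z'` and supplies a replacement leaf.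
        obtain ⟨j2, hj2, hj2'⟩ : ∃ j2 : Fin 3, j2 ≠ j0 ∧ j2 ≠ j :=
          (by decide : ∀ j0 j : Fin 3, ∃ j2 : Fin 3, j2 ≠ j0 ∧ j2 ≠ j) j0 j
        obtain ⟨w, hw⟩ := hne z
        have hsub2 := hcross z z' j2 j' hne'.symm (hj0 j2 hj2) ⟨w, hsub (Or.inr hw), Or.inr hw⟩
        obtain ⟨y2, hy2Y, hy2A⟩ := hY z hz j2
        refine ⟨y2, Finset.mem_erase.2 ⟨?_, hy2Y⟩, hsub2 (Or.inl hy2A)⟩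
        rintro rfl
        exact Set.disjoint_left.1 (hdisj z hj2') hy2A hyA
      · exact ⟨y', Finset.mem_erase.2 ⟨hyy, hy'Y⟩, hy'A⟩) (by
      rw [Finset.card_erase_of_mem hz, hn]; rfl)
    rw [Finset.card_erase_of_mem hyY] at key
    have : 0 < Y.card := Finset.card_pos.2 ⟨y, hyY⟩
    omega

lemma IsTrifurcation.reachable_core {G : SimpleGraph V} {n : ℕ} {k : Fin (n + 1) → V}
    {a : Fin 3 → V} (h : IsTrifurcation G n k a) {K : Set V} (hK : Disjoint K (Set.range k))
    (i : Fin (n + 1)) : (deleteVerts G K).Reachable (k 0) (k i) := by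
  have hk : ∀ i, k i ∉ K := fun i hi => Set.disjoint_left.1 hK hi ⟨i, rfl⟩
  induction i using Fin.induction with
  | zero => exact SimpleGraph.Reachable.refl _
  | succ i ih =>
    have : (deleteVerts G K).Adj (k i.castSucc) (k i.succ) := ⟨h.chain i, hk _, hk _⟩
    exact ih.trans this.reachable

/-- A branch and its core stay connected to each other when a set avoiding both is deleted. With `K`
the core of another trifurcation, this yields the nesting hypothesis `hcross` of
`card_le_of_branching`. -/
lemma IsTrifurcation.subset_cluster {G : SimpleGraph V} {n : ℕ} {k : Fin (n + 1) → V}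
    {a : Fin 3 → V} (h : IsTrifurcation G n k a) {K : Set V} (hK : Disjoint K (Set.range k))
    (j : Fin 3) (hj : Disjoint K (cluster (deleteVerts G (Set.range k)) (a j))) :
    cluster (deleteVerts G (Set.range k)) (a j) ∪ Set.range k ⊆
      cluster (deleteVerts G K) (a j) := by
  have hA : ∀ y, (deleteVerts G (Set.range k)).Reachable (a j) y → y ∉ K :=
    fun y hy hyK => Set.disjoint_left.1 hj hyK hy
  rintro y (hy | ⟨i, rfl⟩)
  · exact reachable_of_adj_imp hy fun u v hu huv =>
      ⟨huv.1, hA u hu, hA v (hu.trans huv.reachable)⟩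
  · obtain ⟨i0, hi0⟩ := h.attached j
    have h1 : (deleteVerts G K).Adj (a j) (k i0) :=
      ⟨hi0.symm, hA _ (SimpleGraph.Reachable.refl _),
        fun hi => Set.disjoint_left.1 hK hi ⟨i0, rfl⟩⟩
    exact h1.reachable.trans ((h.reachable_core hK i0).symm.trans (h.reachable_core hK i))

/-- Disjoint trifurcations inside a finite set `W` are at most twice as many as the points of `W`
with a neighbour outside `W`. -/
lemma card_trifurcation_le {ι : Type*} [Fintype ι] (G : SimpleGraph V) (n : ι → ℕ)
    (k : (z : ι) → Fin (n z + 1) → V) (a : ι → Fin 3 → V)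
    (ht : ∀ z, IsTrifurcation G (n z) (k z) (a z))
    (hdisj : Pairwise fun z z' => Disjoint (Set.range (k z)) (Set.range (k z')))
    (W : Set V) (hW : W.Finite) (hkW : ∀ z i, k z i ∈ W) (Y : Finset V)
    (hY : ∀ x ∈ W, ∀ y, y ∉ W → G.Adj x y → x ∈ Y) : Fintype.card ι ≤ 2 * Y.card := by
  classical
  -- The factor 2 comes from treating separately the cores that meet `Y`, which inject into `Y` by
  -- disjointness, and those that avoid it, which are bounded by their branches.
  have hbad : (Finset.univ.filter fun z => ∃ i, k z i ∈ Y).card ≤ Y.card := by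
    choose! f hf using fun (z : ι) (hz : ∃ i, k z i ∈ Y) => hz
    refine Finset.card_le_card_of_injOn (fun z => k z (f z))
      (fun z hz => hf z (Finset.mem_filter.1 hz).2) ?_
    intro z hz z' hz' heq
    by_contra hne
    exact Set.disjoint_left.1 (hdisj hne) ⟨f z, rfl⟩ ⟨f z', heq.symm⟩
  have hgood : (Finset.univ.filter fun z => ¬ ∃ i, k z i ∈ Y).card ≤ Y.card := by
    refine card_le_of_branching (fun z => Set.range (k z))
      (fun z j => cluster (deleteVerts G (Set.range (k z))) (a z j)) (fun z => ⟨_, 0, rfl⟩)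
      ?_ ?_ ?_ ?_ _ Y ?_
    · intro z i j hij
      refine Set.disjoint_left.2 fun y hi hj => (ht z).separated hij ?_
      exact SimpleGraph.Reachable.trans hi (SimpleGraph.Reachable.symm hj)
    · intro z j
      exact Set.disjoint_left.2 fun y hy hj =>
        notMem_of_reachable_deleteVerts ((ht z).notMem j) hj hy
    · intro z z' hne
      by_cases hj : ∃ j, ¬ Disjoint (Set.range (k z'))
          (cluster (deleteVerts G (Set.range (k z))) (a z j))
      · obtain ⟨j, hj⟩ := hj
        refine ⟨j, fun j' hj' => ?_⟩
        by_contra hd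
        obtain ⟨_, ⟨i, rfl⟩, hi⟩ := Set.not_disjoint_iff.1 hj
        obtain ⟨_, ⟨i', rfl⟩, hi'⟩ := Set.not_disjoint_iff.1 hd
        refine (ht z).separated hj'.symm ?_
        have h1 := (ht z').reachable_core (hdisj hne) i
        have h2 := (ht z').reachable_core (hdisj hne) i'
        exact SimpleGraph.Reachable.trans hi (h1.symm.trans
          (h2.trans (SimpleGraph.Reachable.symm hi')))
      · push Not at hj
        exact ⟨0, fun j' _ => hj j'⟩
    · rintro z z' j j' hne hd ⟨w, hw1, hw2⟩ y hy
      have hsub := (ht z).subset_cluster (hdisj hne.symm) j hd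
      exact SimpleGraph.Reachable.trans hw1 ((hsub hw2).symm.trans (hsub hy))
    · intro z hz j
      have hz := (Finset.mem_filter.1 hz).2
      -- A core avoiding `Y` has all its neighbours in `W`. The branch therefore starts inside the
      -- finite set `W`, and being infinite it must leave `W` through a point of `Y`.
      have haW : a z j ∈ W := by
        by_contra haW
        obtain ⟨i, hi⟩ := (ht z).attached j
        exact hz ⟨i, hY _ (hkW z i) _ haW hi⟩
      obtain ⟨y, hy, hyW⟩ := ((ht z).infinite j).exists_notMem_finite hW
      by_contra hcon
      refine hyW (reachable_induction hy (fun y => y ∈ W) haW fun u v hu huW huv => ?_)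
      by_contra hvW
      exact hcon ⟨u, hY u huW v hvW huv.1, hu⟩
  have := Finset.card_filter_add_card_filter_not (s := (Finset.univ : Finset ι))
    (fun z => ∃ i, k z i ∈ Y)
  rw [Finset.card_univ] at this
  omega

/-- If only finitely many edges are added to `G`, every infinite cluster of the new graph contains
an infinite cluster of `G`. -/
lemma exists_infinite_cluster_of_finite_change {G G' : SimpleGraph V} {F : Set V} (hF : F.Finite)
    (hc : ∀ x y, G'.Adj x y → ¬ G.Adj x y → x ∈ F ∧ y ∈ F) {y : V}
    (hy : (cluster G' y).Infinite) : ∃ x, G'.Reachable y x ∧ (cluster G x).Infinite := by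
  by_contra! hcon
  -- Any new edge ends in `F`, so the new cluster is covered by the old cluster of `y` and the old
  -- clusters of finitely many points of `F`.
  refine hy (((hcon y (SimpleGraph.Reachable.refl y)).union
    (Set.Finite.biUnion (hF.inter_of_left (cluster G' y)) fun f hf => hcon f hf.2)).subset ?_)
  intro u hu
  refine reachable_induction hu (fun u => u ∈ cluster G y ∪ ⋃ f ∈ F ∩ cluster G' y, cluster G f)
    (Or.inl (SimpleGraph.Reachable.refl y)) fun u v hu hmem huv => ?_
  by_cases hG : G.Adj u v
  · rcases hmem with h | h
    · exact Or.inl (SimpleGraph.Reachable.trans h hG.reachable)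
    · simp only [Set.mem_iUnion] at h
      obtain ⟨f, hf, h⟩ := h
      exact Or.inr (Set.mem_biUnion hf (SimpleGraph.Reachable.trans h hG.reachable))
  · exact Or.inr (Set.mem_biUnion (show v ∈ F ∩ cluster G' y from
      ⟨(hc u v huv hG).2, hu.trans huv.reachable⟩) (SimpleGraph.Reachable.refl v))

/-- Merging two infinite clusters out of two by adding finitely many edges leaves at most one. -/
lemma not_hasInfiniteClusters_two_of_merge {G G' : SimpleGraph V} (hle : G ≤ G') {F : Set V}
    (hF : F.Finite) (hc : ∀ x y, G'.Adj x y → ¬ G.Adj x y → x ∈ F ∧ y ∈ F)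
    (h3 : ¬ HasInfiniteClusters G Set.univ 3) (x : Fin 2 → V)
    (hinf : ∀ i, (cluster G (x i)).Infinite)
    (hsep : Pairwise fun i j => ¬ G.Reachable (x i) (x j)) (hm : G'.Reachable (x 0) (x 1)) :
    ¬ HasInfiniteClusters G' Set.univ 2 := by
  rintro ⟨y, -, hyinf, hysep⟩
  -- An infinite cluster of `G'` contains one of `G`. Unless it contains `x 0`, this would be a
  -- third infinite cluster of `G`.
  have hone : ∀ i, G'.Reachable (y i) (x 0) := by
    intro i
    obtain ⟨w, hw, hwinf⟩ := exists_infinite_cluster_of_finite_change hF hc (hyinf i)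
    by_contra hcon
    have h0 : ¬ G.Reachable w (x 0) := fun h => hcon (hw.trans (h.mono hle))
    have h1 : ¬ G.Reachable w (x 1) := fun h => hcon (hw.trans ((h.mono hle).trans hm.symm))
    have h01 : ¬ G.Reachable (x 0) (x 1) := hsep (by decide)
    refine h3 ⟨![w, x 0, x 1], fun _ => Set.mem_univ _, fun i => ?_, ?_⟩
    · fin_cases i
      · exact hwinf
      · exact hinf 0
      · exact hinf 1
    · intro i j hij
      fin_cases i <;> fin_cases j
      · exact absurd rfl hij
      · exact h0
      · exact h1
      · exact fun h => h0 h.symm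
      · exact absurd rfl hij
      · exact h01
      · exact fun h => h1 h.symm
      · exact fun h => h01 h.symm
      · exact absurd rfl hij
  exact hysep (show (0 : Fin 2) ≠ 1 by decide) ((hone 0).trans (hone 1).symm)

/-- Supplies the core of a trifurcation. The walk may revisit vertices, which is harmless because
`IsTrifurcation` does not require `k` to be injective. -/
lemma exists_walk_support_superset {G : SimpleGraph V} {x : V} {F : Set V} (hF : F.Finite)
    (h : ∀ y ∈ F, G.Reachable x y) : ∃ (y : V) (w : G.Walk x y), ∀ z ∈ F, z ∈ w.support := by
  induction F, hF using Set.Finite.induction_on with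
  | empty => exact ⟨x, SimpleGraph.Walk.nil, by simp⟩
  | @insert b F _ _ ih =>
    obtain ⟨y, w, hw⟩ := ih fun y hy => h y (Set.mem_insert_of_mem _ hy)
    obtain ⟨p⟩ := h b (Set.mem_insert _ _)
    obtain ⟨q⟩ : G.Reachable y b := w.reachable.symm.trans p.reachable
    refine ⟨b, w.append q, ?_⟩
    rintro z (rfl | hz)
    · exact SimpleGraph.Walk.end_mem_support _
    · exact (SimpleGraph.Walk.mem_support_append_iff _ _).2 (Or.inl (hw z hz))

/-- Removing finitely many vertices from an infinite locally finite cluster meeting them leaves an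
infinite cluster adjacent to them. -/
lemma exists_infinite_branch {G : SimpleGraph V} (hlf : ∀ x, {y | G.Adj x y}.Finite) {K : Set V}
    (hK : K.Finite) {x : V} (hx : x ∈ K) (hinf : (cluster G x).Infinite) :
    ∃ a, G.Reachable x a ∧ a ∉ K ∧ (∃ u ∈ K, G.Adj u a) ∧
      (cluster (deleteVerts G K) a).Infinite := by
  by_contra! hcon
  let N : Set V := {a | G.Reachable x a ∧ a ∉ K ∧ ∃ u ∈ K, G.Adj u a}
  have hN : N.Finite := (hK.biUnion fun u _ => hlf u).subset fun a ha => by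
    obtain ⟨-, -, u, hu, hua⟩ := ha
    exact Set.mem_biUnion hu hua
  -- The cluster consists of points of `K` and of the branches of the finitely many neighbours in
  -- `N`; if all these branches were finite, so would be the cluster.
  refine hinf ((hK.union (hN.biUnion fun a ha => hcon a ha.1 ha.2.1
    (by obtain ⟨u, hu⟩ := ha.2.2; exact ⟨u, hu⟩))).subset ?_)
  intro y hy
  refine reachable_induction hy (fun y => y ∈ K ∪ ⋃ a ∈ N, cluster (deleteVerts G K) a)
    (Or.inl hx) fun u v hu hmem huv => ?_
  by_cases hv : v ∈ K
  · exact Or.inl hv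
  by_cases huK : u ∈ K
  · exact Or.inr (Set.mem_biUnion (show v ∈ N from ⟨hu.trans huv.reachable, hv, u, huK, huv⟩)
      (SimpleGraph.Reachable.refl v))
  · rcases hmem with h | h
    · exact absurd h huK
    · simp only [Set.mem_iUnion] at h
      obtain ⟨a, ha, h⟩ := h
      have hd : (deleteVerts G K).Adj u v := ⟨huv, huK, hv⟩
      exact Or.inr (Set.mem_biUnion ha (SimpleGraph.Reachable.trans h hd.reachable))

/-- Joining three infinite clusters by adding finitely many edges creates a trifurcation. -/
lemma exists_isTrifurcation_of_merge {G G' : SimpleGraph V} (hle : G ≤ G') {F : Set V}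
    (hF : F.Finite) (hc : ∀ x y, G'.Adj x y → ¬ G.Adj x y → x ∈ F ∧ y ∈ F)
    (hlf : ∀ x, {y | G'.Adj x y}.Finite) (x : Fin 3 → V)
    (hinf : ∀ i, (cluster G (x i)).Infinite)
    (hsep : Pairwise fun i j => ¬ G.Reachable (x i) (x j))
    (hm : ∀ i, G'.Reachable (x 0) (x i)) :
    ∃ (n : ℕ) (k : Fin (n + 1) → V) (a : Fin 3 → V), IsTrifurcation G' n k a := by
  obtain ⟨y, w, hw⟩ := exists_walk_support_superset (G := G') (x := x 0)
    (F := (F ∩ cluster G' (x 0)) ∪ Set.range x)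
    ((hF.inter_of_left _).union (Set.finite_range x)) (by
      rintro y (hy | ⟨i, rfl⟩)
      · exact hy.2
      · exact hm i)
  let k : Fin (w.length + 1) → V := fun i => w.getVert i
  have hk : ∀ z, z ∈ w.support → z ∈ Set.range k := by
    intro z hz
    obtain ⟨i, hi, hil⟩ := SimpleGraph.Walk.mem_support_iff_exists_getVert.1 hz
    exact ⟨⟨i, by omega⟩, hi⟩
  have hKF : (F ∩ cluster G' (x 0)) ⊆ Set.range k := fun z hz => hk z (hw z (Or.inl hz))
  have hxK : ∀ i, x i ∈ Set.range k := fun i => hk _ (hw _ (Or.inr ⟨i, rfl⟩))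
  -- The branches are taken in `G`, one in each of the three old clusters, so that they inherit
  -- separation from `hsep`.
  choose a haR haK haA haI using fun i => exists_infinite_branch
    (fun z => (hlf z).subset fun y hy => hle hy) (Set.finite_range k) (hxK i) (hinf i)
  refine ⟨w.length, k, a, ⟨?_, ?_, haK, ?_, ?_⟩⟩
  · intro i
    exact w.adj_getVert_succ i.2
  · intro j
    obtain ⟨_, ⟨i, rfl⟩, hu⟩ := haA j
    exact ⟨i, hle hu⟩
  · exact fun j => (haI j).mono (cluster_mono (deleteVerts_mono hle _) _)
  · intro i j hij hreach
    refine hsep hij ((haR i).trans (SimpleGraph.Reachable.trans ?_ (haR j).symm))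
    -- Within this cluster an edge of `G'` absent from `G` has both ends in `F`, hence on the core.
    -- A path avoiding the core thus uses edges of `G` only.
    refine reachable_of_adj_imp hreach fun u v hu huv => ?_
    by_contra hG
    refine huv.2.1 (hKF ⟨(hc u v huv.1 hG).1, ?_⟩)
    exact (hm i).trans (((haR i).mono hle).trans (hu.mono (deleteVerts_le _ _)))

end Graph

/-! ### Invariance under graph isomorphisms -/

section Iso

variable {V V' : Type*} {G : SimpleGraph V} {G' : SimpleGraph V'}

lemma infinite_cluster_iso (φ : G ≃g G') {x : V} (h : (cluster G x).Infinite) :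
    (cluster G' (φ x)).Infinite := by
  refine (h.image φ.injective.injOn).mono ?_
  rintro _ ⟨y, hy, rfl⟩
  exact φ.reachable_iff.2 hy

lemma HasInfiniteClusters.iso (φ : G ≃g G') {U : Set V} {k : ℕ} (h : HasInfiniteClusters G U k) :
    HasInfiniteClusters G' (φ '' U) k := by
  obtain ⟨x, hU, hinf, hsep⟩ := h
  exact ⟨fun i => φ (x i), fun i => ⟨_, hU i, rfl⟩, fun i => infinite_cluster_iso φ (hinf i),
    fun i j hij h => hsep hij (φ.reachable_iff.1 h)⟩

/-- An isomorphism restricts to the graphs with corresponding vertices deleted. -/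
def deleteVertsIso (φ : G ≃g G') (K : Set V) (K' : Set V') (h : ∀ x, φ x ∈ K' ↔ x ∈ K) :
    deleteVerts G K ≃g deleteVerts G' K' where
  toEquiv := φ.toEquiv
  map_rel_iff' := by
    intro x y
    change G'.Adj (φ x) (φ y) ∧ φ x ∉ K' ∧ φ y ∉ K' ↔ G.Adj x y ∧ x ∉ K ∧ y ∉ K
    rw [h, h, φ.map_adj_iff]

lemma HasTrifurcation.iso (φ : G ≃g G') {U : Set V} (h : HasTrifurcation G U) :
    HasTrifurcation G' (φ '' U) := by
  obtain ⟨n, k, a, hU, hk⟩ := h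
  have hr : ∀ x, φ x ∈ Set.range (fun i => φ (k i)) ↔ x ∈ Set.range k := by
    intro x
    simp [φ.injective.eq_iff]
  let ψ := deleteVertsIso φ (Set.range k) (Set.range fun i => φ (k i)) hr
  refine ⟨n, fun i => φ (k i), fun j => φ (a j), fun i => ⟨_, hU i, rfl⟩,
    fun i => φ.map_adj_iff.2 (hk.chain i), ?_, fun j => ?_, fun j => ?_, fun i j hij h => ?_⟩
  · intro j
    obtain ⟨i, hi⟩ := hk.attached j
    exact ⟨i, φ.map_adj_iff.2 hi⟩
  · rw [hr]
    exact hk.notMem j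
  · exact infinite_cluster_iso ψ (hk.infinite j)
  · exact hk.separated hij (ψ.reachable_iff.1 h)

end Iso

/-! ### The secrecy graph in space and the effect of removing red points -/

section Geometry

variable {d : ℕ}

/-- The bidirectional secrecy graph as a graph on the whole space, in which points outside `S` are
isolated. -/
def secGraph (S R : Set (Space d)) : SimpleGraph (Space d) where
  Adj x y := x ∈ S ∧ y ∈ S ∧ x ≠ y ∧ ∀ z ∈ R, dist x y ≤ dist z x ∧ dist x y ≤ dist z y
  symm := ⟨fun x y h => ⟨h.2.1, h.1, h.2.2.1.symm, fun z hz => by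
    rw [dist_comm y x]; exact (h.2.2.2 z hz).symm⟩⟩
  loopless := ⟨fun _ h => h.2.2.1 rfl⟩

lemma bidirectionalGraph_adj (S R : Config d) (x y : S.points) :
    (bidirectionalGraph S R).Adj x y ↔ (secGraph S.points R.points).Adj x y := by
  have h : (bidirectionalGraph S R).Adj x y ↔
      x ≠ y ∧ (directedGraph S R).Adj x y ∧ (directedGraph S R).Adj y x := Iff.rfl
  rw [h]
  simp only [directedGraph, secGraph, Metric.mem_ball, not_lt, ← dist_eq_norm,
    dist_comm (y : Space d) (x : Space d)]
  constructor
  · rintro ⟨hne, ⟨-, h1⟩, -, h2⟩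
    exact ⟨x.2, y.2, fun h => hne (Subtype.ext h), fun z hz => ⟨h1 z hz, h2 z hz⟩⟩
  · rintro ⟨-, -, hne, h⟩
    have hne' : x ≠ y := fun h => hne (congrArg _ h)
    exact ⟨hne', ⟨hne', fun z hz => (h z hz).1⟩, hne'.symm, fun z hz => (h z hz).2⟩

lemma bidirectionalGraph_reachable (S R : Config d) (x y : S.points) :
    (bidirectionalGraph S R).Reachable x y ↔ (secGraph S.points R.points).Reachable x y := by
  constructor
  · intro h
    exact h.map (⟨Subtype.val, fun {a b} hab => (bidirectionalGraph_adj S R a b).1 hab⟩ :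
      bidirectionalGraph S R →g secGraph S.points R.points)
  · intro h
    refine reachable_induction h
      (fun y => ∀ hy : y ∈ S.points, (bidirectionalGraph S R).Reachable x ⟨y, hy⟩)
      (fun _ => SimpleGraph.Reachable.refl _) (fun u v _ hu huv hv => ?_) y.2
    exact (hu huv.1).trans
      ((bidirectionalGraph_adj S R ⟨u, huv.1⟩ ⟨v, hv⟩).2 huv).reachable

lemma cluster_subset_points {S R : Set (Space d)} {x : Space d} :
    cluster (secGraph S R) x ⊆ insert x S := fun _ hy =>
  reachable_induction hy (fun y => y ∈ insert x S) (Set.mem_insert _ _)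
    fun _ _ _ _ huv => Or.inr huv.2.1

lemma mem_of_infinite_cluster {S R : Set (Space d)} {x : Space d}
    (h : (cluster (secGraph S R) x).Infinite) : x ∈ S := by
  by_contra hx
  refine h ((Set.finite_singleton x).subset fun y hy => ?_)
  exact reachable_induction hy (fun y => y = x) rfl fun u v _ hu huv =>
    absurd (hu ▸ huv.1) hx

lemma infinite_supp_iff (S R : Config d) (x : S.points) :
    ((bidirectionalGraph S R).connectedComponentMk x).supp.Infinite ↔
      (cluster (secGraph S.points R.points) x).Infinite := by
  have : cluster (secGraph S.points R.points) x =
      Subtype.val '' ((bidirectionalGraph S R).connectedComponentMk x).supp := by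
    ext y
    simp only [cluster, Set.mem_ofPred_eq, Set.mem_image, SimpleGraph.ConnectedComponent.mem_supp_iff,
      SimpleGraph.ConnectedComponent.eq, bidirectionalGraph_reachable]
    constructor
    · intro h
      have hy : y ∈ S.points := by
        rcases cluster_subset_points h with rfl | hy
        · exact x.2
        · exact hy
      exact ⟨⟨y, hy⟩, h.symm, rfl⟩
    · rintro ⟨y, h, rfl⟩
      exact h.symm
  rw [this, Set.infinite_image_iff Subtype.val_injective.injOn]

lemma numInfiniteComponents_eq_zero (S R : Config d)
    (h : ¬ HasInfiniteClusters (secGraph S.points R.points) Set.univ 1) :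
    numInfiniteComponents (bidirectionalGraph S R) = 0 := by
  rw [numInfiniteComponents, Set.encard_eq_zero, Set.eq_empty_iff_forall_notMem]
  intro C hC
  induction C using SimpleGraph.ConnectedComponent.ind with
  | h x =>
    exact h ⟨fun _ => x, fun _ => Set.mem_univ _, fun _ => (infinite_supp_iff S R x).1 hC,
      fun i j hij => absurd (Subsingleton.elim i j) hij⟩

lemma numInfiniteComponents_eq_one (S R : Config d)
    (h1 : HasInfiniteClusters (secGraph S.points R.points) Set.univ 1)
    (h2 : ¬ HasInfiniteClusters (secGraph S.points R.points) Set.univ 2) :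
    numInfiniteComponents (bidirectionalGraph S R) = 1 := by
  obtain ⟨x, -, hx, -⟩ := h1
  have hxS := mem_of_infinite_cluster (hx 0)
  rw [numInfiniteComponents, Set.encard_eq_one]
  refine ⟨(bidirectionalGraph S R).connectedComponentMk ⟨x 0, hxS⟩, ?_⟩
  ext C
  simp only [Set.mem_ofPred_eq, Set.mem_singleton_iff]
  constructor
  · induction C using SimpleGraph.ConnectedComponent.ind with
    | h y =>
      intro hy
      rw [infinite_supp_iff] at hy
      rw [SimpleGraph.ConnectedComponent.eq, bidirectionalGraph_reachable]
      by_contra hcon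
      refine h2 ⟨![y, x 0], fun _ => Set.mem_univ _, fun i => ?_, fun i j hij => ?_⟩
      · fin_cases i
        · exact hy
        · exact hx 0
      · fin_cases i <;> fin_cases j
        · exact absurd rfl hij
        · exact hcon
        · exact fun h => hcon h.symm
        · exact absurd rfl hij
  · rintro rfl
    exact (infinite_supp_iff S R _).2 (hx 0)

/-- Translation of the point sets translates the secrecy graph. -/
def secGraphTranslate (v : Space d) (S R : Set (Space d)) :
    secGraph S R ≃g secGraph ((· + v) '' S) ((· + v) '' R) where
  toEquiv := Equiv.addRight v
  map_rel_iff' := by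
    intro x y
    change (_ ∧ _ ∧ x + v ≠ y + v ∧ ∀ z ∈ (· + v) '' R, dist (x + v) (y + v) ≤ dist z (x + v) ∧
      dist (x + v) (y + v) ≤ dist z (y + v)) ↔ _
    rw [Set.forall_mem_image]
    simp only [dist_add_right]
    simp [secGraph]

/-- Finitely many points of `R` suffice to have, for every direction, a point far away in that
direction. -/
def Surrounds (R : Set (Space d)) : Prop :=
  ∀ M : ℕ, ∃ Z : Set (Space d), Z.Finite ∧ Z ⊆ R ∧ ∀ x, ∃ z ∈ Z, M * ‖x‖ ≤ inner ℝ x z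

lemma Surrounds.exists_norm_ge (hd : 1 ≤ d) {R : Set (Space d)} (h : Surrounds R) (M : ℕ) :
    ∃ z ∈ R, (M : ℝ) ≤ ‖z‖ := by
  obtain ⟨Z, -, hZR, hZ⟩ := h M
  obtain ⟨z, hz, hxz⟩ := hZ (EuclideanSpace.single (⟨0, hd⟩ : Fin d) (1 : ℝ))
  refine ⟨z, hZR hz, ?_⟩
  have := real_inner_le_norm (EuclideanSpace.single (⟨0, hd⟩ : Fin d) (1 : ℝ)) z
  rw [PiLp.norm_single] at this hxz
  norm_num at this hxz
  linarith

/-- A single red point `z` bounds the length of every edge at `x` by `dist z x`. -/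
lemma finite_neighbors {S R : Set (Space d)}
    (hS : ∀ B : Set (Space d), Bornology.IsBounded B → (S ∩ B).Finite) (hR : R.Nonempty)
    (x : Space d) : {y | (secGraph S R).Adj x y}.Finite := by
  obtain ⟨z, hz⟩ := hR
  refine (hS (Metric.closedBall x (dist z x)) Metric.isBounded_closedBall).subset ?_
  intro y hy
  exact ⟨hy.2.1, by rw [Metric.mem_closedBall, dist_comm]; exact (hy.2.2.2 z hz).1⟩

/-- Expanding the square gives ‖x - z‖² ≤ ‖x‖² - (2M + 1)‖x‖ ≤ (‖x‖ - M)². So, seen from a distant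
`x`, the red point `z` blocks whatever a point `w` of the ball blocks. -/
lemma dist_le_of_inner_ge {x z w : Space d} {M : ℝ} (hM : 0 ≤ M) (hxz : (M + 1) * ‖x‖ ≤ inner ℝ x z)
    (hz : ‖z‖ ^ 2 ≤ ‖x‖) (hx : M ≤ ‖x‖) (hw : ‖w‖ ≤ M) : dist z x ≤ dist w x := by
  have h1 : dist z x ≤ ‖x‖ - M := by
    rw [dist_comm, dist_eq_norm]
    refine le_of_sq_le_sq ?_ (by linarith)
    rw [norm_sub_sq_real]
    nlinarith [norm_nonneg x]
  have h2 : ‖x‖ - ‖w‖ ≤ dist w x := by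
    rw [dist_comm, dist_eq_norm]
    exact norm_sub_norm_le x w
  linarith

/-- Removing the points of `R` in a ball changes edges of the secrecy graph only in a bounded
region, when `R` surrounds that ball. -/
lemma Surrounds.exists_bound_change (hd : 1 ≤ d) {R : Set (Space d)} (h : Surrounds R) (M : ℕ) :
    ∃ r : ℝ, ∀ (S : Set (Space d)) (x y : Space d),
      (secGraph S (R \ Metric.ball 0 M)).Adj x y → ¬ (secGraph S R).Adj x y →
        x ∈ Metric.ball 0 r ∧ y ∈ Metric.ball 0 r := by
  obtain ⟨Z, hZf, hZR, hZ⟩ := h (M + 1)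
  obtain ⟨z1, hz1R, hz1⟩ := h.exists_norm_ge hd M
  obtain ⟨b, hb⟩ := (hZf.image fun z => ‖z‖ ^ 2).bddAbove
  have hb' : ∀ z ∈ Z, ‖z‖ ^ 2 ≤ b := fun z hz => hb ⟨z, hz, rfl⟩
  -- Beyond `r0` the norm of `x` exceeds both `M` and ‖z‖² for every `z` in `Z`, as
  -- `dist_le_of_inner_ge` requires. The surplus 1 in `M + 1` keeps the blocking point outside the
  -- removed ball.
  set r0 : ℝ := M + 1 + |b| with hr0
  have hbabs := le_abs_self b
  have hb0 := abs_nonneg b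
  have hM0 : (0 : ℝ) ≤ M := Nat.cast_nonneg M
  have key : ∀ (S : Set (Space d)) (x y : Space d),
      (secGraph S (R \ Metric.ball 0 M)).Adj x y → ∀ w ∈ R, dist w x < dist x y → ‖x‖ < r0 := by
    intro S x y hxy w hw hlt
    by_contra! hx
    have hwM : ‖w‖ < M := by
      by_contra hwM
      exact absurd (hxy.2.2.2 w ⟨hw, by simpa using hwM⟩).1 (not_le.2 hlt)
    obtain ⟨z, hzZ, hz⟩ := hZ x
    push_cast at hz
    have hle := dist_le_of_inner_ge (w := w) hM0 hz ((hb' z hzZ).trans (by linarith))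
      (by linarith) hwM.le
    have hzM : (M : ℝ) ≤ ‖z‖ := by
      have h1 := real_inner_le_norm x z
      have hx0 : 0 < ‖x‖ := by linarith
      have h2 : (M + 1 : ℝ) ≤ ‖z‖ := by
        refine le_of_mul_le_mul_right ?_ hx0
        linarith [mul_comm ‖x‖ ‖z‖]
      linarith
    have := (hxy.2.2.2 z ⟨hZR hzZ, by simpa using hzM⟩).1
    linarith
  have hy : ∀ (S : Set (Space d)) (x y : Space d),
      (secGraph S (R \ Metric.ball 0 M)).Adj x y → ‖x‖ < r0 →
        ‖x‖ < 2 * r0 + ‖z1‖ ∧ ‖y‖ < 2 * r0 + ‖z1‖ := by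
    intro S x y hxy hx
    have h1 := (hxy.2.2.2 z1 ⟨hz1R, by simpa using hz1⟩).1
    have h2 : ‖y‖ ≤ ‖x‖ + dist x y := by
      have := norm_sub_norm_le y x
      rw [dist_comm, dist_eq_norm]
      linarith
    have h3 : dist z1 x ≤ ‖z1‖ + ‖x‖ := by
      rw [dist_eq_norm]
      exact norm_sub_le _ _
    have := norm_nonneg z1
    constructor <;> linarith
  -- The surviving point `z1` bounds the edge length by ‖z1‖ + ‖x‖, so the other endpoint has norm
  -- at most 2‖x‖ + ‖z1‖.
  refine ⟨2 * r0 + ‖z1‖, fun S x y hxy hn => ?_⟩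
  simp only [mem_ball_zero_iff]
  by_cases hw : ∃ w ∈ R, dist w x < dist x y
  · obtain ⟨w, hw, hlt⟩ := hw
    exact hy S x y hxy (key S x y hxy w hw hlt)
  · push Not at hw
    have hw2 : ∃ w ∈ R, dist w y < dist x y := by
      by_contra! hw2
      exact hn ⟨hxy.1, hxy.2.1, hxy.2.2.1, fun z hz => ⟨hw z hz, hw2 z hz⟩⟩
    obtain ⟨w, hw, hlt⟩ := hw2
    exact (hy S y x hxy.symm (key S y x hxy.symm w hw (by rwa [dist_comm y x]))).symm

lemma secGraph_anti (S : Set (Space d)) {R R' : Set (Space d)} (h : R' ⊆ R) :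
    secGraph S R ≤ secGraph S R' :=
  fun _ _ ha => ⟨ha.1, ha.2.1, ha.2.2.1, fun z hz => ha.2.2.2 z (h hz)⟩

/-- Points of `S` in a ball are joined once the points of `R` in the three times larger ball are
removed. -/
lemma reachable_of_mem_ball {S R : Set (Space d)} {L : ℝ} {x y : Space d} (hx : x ∈ S) (hy : y ∈ S)
    (hxL : x ∈ Metric.ball 0 L) (hyL : y ∈ Metric.ball 0 L) :
    (secGraph S (R \ Metric.ball 0 (3 * L))).Reachable x y := by
  rcases eq_or_ne x y with rfl | hne
  · exact SimpleGraph.Reachable.refl _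
  rw [mem_ball_zero_iff] at hxL hyL
  have hxy : dist x y ≤ 2 * L := by
    rw [dist_eq_norm]
    linarith [norm_sub_le x y]
  refine SimpleGraph.Adj.reachable ⟨hx, hy, hne, fun z hz => ?_⟩
  have hz' : 3 * L ≤ ‖z‖ := by simpa using hz.2
  constructor
  · rw [dist_eq_norm z x]
    linarith [norm_sub_norm_le z x]
  · rw [dist_eq_norm z y]
    linarith [norm_sub_norm_le z y]

/-- Two infinite clusters meeting a ball merge when the points of `R` near that ball are removed. -/
lemma not_hasInfiniteClusters_two_of_removal (hd : 1 ≤ d) {S R : Set (Space d)}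
    (hS : ∀ B : Set (Space d), Bornology.IsBounded B → (S ∩ B).Finite) (hR : Surrounds R) (L : ℕ)
    (h2 : HasInfiniteClusters (secGraph S R) (Metric.ball 0 L) 2)
    (h3 : ¬ HasInfiniteClusters (secGraph S R) Set.univ 3) :
    ¬ HasInfiniteClusters (secGraph S (R \ Metric.ball 0 (3 * L))) Set.univ 2 := by
  obtain ⟨r, hr⟩ := hR.exists_bound_change hd (3 * L)
  push_cast at hr
  obtain ⟨x, hxL, hinf, hsep⟩ := h2
  refine not_hasInfiniteClusters_two_of_merge (secGraph_anti S Set.sdiff_subset)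
    (hS (Metric.ball 0 r) Metric.isBounded_ball) (fun x y h hn => ?_) h3 x hinf hsep
    (reachable_of_mem_ball (mem_of_infinite_cluster (hinf 0)) (mem_of_infinite_cluster (hinf 1))
      (hxL 0) (hxL 1))
  exact ⟨⟨h.1, (hr S x y h hn).1⟩, h.2.1, (hr S x y h hn).2⟩

/-- Three infinite clusters meeting a ball form a trifurcation when the points of `R` near that
ball are removed. -/
lemma exists_hasTrifurcation_of_removal (hd : 1 ≤ d) {S R : Set (Space d)}
    (hS : ∀ B : Set (Space d), Bornology.IsBounded B → (S ∩ B).Finite) (hR : Surrounds R) (L : ℕ)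
    (h3 : HasInfiniteClusters (secGraph S R) (Metric.ball 0 L) 3) :
    ∃ M : ℕ, HasTrifurcation (secGraph S (R \ Metric.ball 0 (3 * L))) (Metric.ball 0 M) := by
  obtain ⟨r, hr⟩ := hR.exists_bound_change hd (3 * L)
  obtain ⟨z1, hz1R, hz1⟩ := hR.exists_norm_ge hd (3 * L)
  push_cast at hr hz1
  obtain ⟨x, hxL, hinf, hsep⟩ := h3
  obtain ⟨n, k, a, hk⟩ := exists_isTrifurcation_of_merge
    (secGraph_anti S (R := R) (R' := R \ Metric.ball 0 (3 * L)) Set.sdiff_subset)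
    (hS (Metric.ball 0 r) Metric.isBounded_ball)
    (fun x y h hn => ⟨⟨h.1, (hr S x y h hn).1⟩, h.2.1, (hr S x y h hn).2⟩)
    (finite_neighbors hS ⟨z1, hz1R, by simpa using hz1⟩) x hinf hsep
    (fun i => reachable_of_mem_ball (mem_of_infinite_cluster (hinf 0))
      (mem_of_infinite_cluster (hinf i)) (hxL 0) (hxL i))
  obtain ⟨b, hb⟩ := (Set.finite_range fun i => ‖k i‖).bddAbove
  obtain ⟨M, hM⟩ := exists_nat_gt b
  refine ⟨M, n, k, a, fun i => ?_, hk⟩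
  rw [mem_ball_zero_iff]
  exact (hb ⟨i, rfl⟩).trans_lt hM

end Geometry

/-! ### Measurability of events about configurations -/

section ConfigMeasurability

variable {d : ℕ}

lemma Config.finite_inter (S : Config d) {B : Set (Space d)} (hB : Bornology.IsBounded B) :
    (S.points ∩ B).Finite := S.2 B hB

lemma measurable_count {B : Set (Space d)} (hB : MeasurableSet B) (hb : Bornology.IsBounded B) :
    Measurable (Config.count B) := by
  rw [measurable_iff_comap_le]
  exact le_iSup_of_le B (le_iSup_of_le hB (le_iSup_of_le hb le_rfl))

lemma measurable_config {α : Type*} [MeasurableSpace α] {f : α → Config d}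
    (h : ∀ B, MeasurableSet B → Bornology.IsBounded B → Measurable fun a => (f a).count B) :
    Measurable f := by
  rw [measurable_iff_comap_le]
  simp only [instMeasurableSpaceConfig, MeasurableSpace.comap_iSup, MeasurableSpace.comap_comp,
    iSup_le_iff]
  intro B hB hb
  exact measurable_iff_comap_le.1 (h B hB hb)

/-- The points of a configuration in `A`. -/
def Config.restrict (A : Set (Space d)) (S : Config d) : Config d :=
  ⟨S.points ∩ A, fun B hB => (S.2 B hB).subset fun _ hx => ⟨hx.1.1, hx.2⟩⟩

lemma isBounded_preimage_add {B : Set (Space d)} (hB : Bornology.IsBounded B) (v : Space d) :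
    Bornology.IsBounded ((· + v) ⁻¹' B) := by
  have := (IsometryEquiv.addRight (-v)).isometry.lipschitz.isBounded_image hB
  exact this.subset fun x hx => ⟨x + v, hx, by simp⟩

/-- A configuration shifted by `v`. -/
def Config.translate (v : Space d) (S : Config d) : Config d :=
  ⟨(· + v) '' S.points, fun B hB => by
    refine ((S.2 _ (isBounded_preimage_add hB v)).image (· + v)).subset ?_
    rintro _ ⟨⟨x, hx, rfl⟩, hB⟩
    exact ⟨x, ⟨hx, hB⟩, rfl⟩⟩

lemma Config.points_restrict (A : Set (Space d)) (S : Config d) :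
    (S.restrict A).points = S.points ∩ A := rfl

lemma Config.points_translate (v : Space d) (S : Config d) :
    (S.translate v).points = (· + v) '' S.points := rfl

lemma Config.ext {S T : Config d} (h : S.points = T.points) : S = T := Subtype.ext h

lemma count_restrict (A B : Set (Space d)) (S : Config d) :
    (S.restrict A).count B = S.count (B ∩ A) := by
  rw [Config.count, Config.count, Config.points_restrict, Set.inter_assoc, Set.inter_comm A B]

lemma count_translate (v : Space d) (B : Set (Space d)) (S : Config d) :
    (S.translate v).count B = S.count ((· + v) ⁻¹' B) := by
  rw [Config.count, Config.count, Config.points_translate, ← Set.image_inter_preimage,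
    Set.ncard_image_of_injective _ (add_left_injective v)]

lemma measurable_restrict_config {A : Set (Space d)} (hA : MeasurableSet A) :
    Measurable (Config.restrict A) :=
  measurable_config fun B hB hb => by
    simp only [count_restrict]
    exact measurable_count (hB.inter hA) (hb.subset Set.inter_subset_left)

lemma measurable_translate (v : Space d) : Measurable (Config.translate v) :=
  measurable_config fun B hB hb => by
    simp only [count_translate]
    exact measurable_count (measurable_add_const v hB) (isBounded_preimage_add hb v)

lemma count_eq_zero_iff (S : Config d) {B : Set (Space d)} (hb : Bornology.IsBounded B) :
    S.count B = 0 ↔ ∀ x ∈ S.points, x ∉ B := by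
  rw [Config.count, Set.ncard_eq_zero (S.finite_inter hb), Set.eq_empty_iff_forall_notMem]
  simp

open Classical in
/-- The point of a configuration in `Q`, when there is exactly one. -/
noncomputable def Config.pick (Q : Set (Space d)) (S : Config d) : Space d :=
  if h : ∃ x, S.points ∩ Q = {x} then h.choose else 0

lemma count_eq_one_iff (S : Config d) (Q : Set (Space d)) :
    S.count Q = 1 ↔ ∃ x, S.points ∩ Q = {x} := Set.ncard_eq_one

lemma pick_spec {S : Config d} {Q : Set (Space d)} (h : S.count Q = 1) :
    S.points ∩ Q = {S.pick Q} := by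
  have h' := (count_eq_one_iff S Q).1 h
  rw [Config.pick, dif_pos h']
  exact h'.choose_spec

lemma pick_mem {S : Config d} {Q : Set (Space d)} (h : S.count Q = 1) : S.pick Q ∈ S.points := by
  have : S.pick Q ∈ S.points ∩ Q := by rw [pick_spec h]; rfl
  exact this.1

lemma measurable_pick {Q : Set (Space d)} (hQ : MeasurableSet Q) (hb : Bornology.IsBounded Q) :
    Measurable (Config.pick Q) := by
  classical
  intro A hA
  -- The second part of the union accounts for the default value 0 of `pick` when `Q` does not hold
  -- exactly one point.
  have h : Config.pick Q ⁻¹' A = (Config.count Q ⁻¹' {1} ∩ Config.count (Q ∩ A) ⁻¹' {1}) ∪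
      (Config.count Q ⁻¹' {1}ᶜ ∩ {_S : Config d | (0 : Space d) ∈ A}) := by
    ext S
    simp only [Set.mem_preimage, Set.mem_union, Set.mem_inter_iff, Set.mem_singleton_iff,
      Set.mem_compl_iff, Set.mem_ofPred_eq]
    by_cases h1 : S.count Q = 1
    · simp only [h1, true_and, not_true_eq_false, false_and, or_false]
      have hs := pick_spec h1
      rw [Config.count, ← Set.inter_assoc, hs]
      by_cases hp : S.pick Q ∈ A
      · simp [hp]
      · simp [hp]
    · have h2 : ¬ ∃ x, S.points ∩ Q = {x} := by rwa [← count_eq_one_iff]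
      simp [h1, Config.pick, h2]
  rw [h]
  exact ((measurable_count hQ hb (measurableSet_singleton 1)).inter
    (measurable_count (hQ.inter hA) (hb.subset Set.inter_subset_left)
      (measurableSet_singleton 1))).union
    ((measurable_count hQ hb (measurableSet_singleton 1).compl).inter (MeasurableSet.const _))

/-- A countable family of small balls separating the points of any configuration. -/
noncomputable def smallBall (d : ℕ) (q : ℕ × ℕ) : Set (Space d) :=
  Metric.ball (TopologicalSpace.denseSeq (Space d) q.1) (1 / (q.2 + 1))

lemma exists_smallBall_pick (S : Config d) {x : Space d} (hx : x ∈ S.points) :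
    ∃ q, S.count (smallBall d q) = 1 ∧ S.pick (smallBall d q) = x := by
  have hfin : ((S.points ∩ Metric.ball x 1) \ {x}).Finite :=
    (S.finite_inter Metric.isBounded_ball).subset Set.sdiff_subset
  obtain ⟨ε, hε, hball⟩ := Metric.isOpen_iff.1 hfin.isClosed.isOpen_compl x (by simp)
  -- Two points of the small ball are within 2/(m + 1) of each other. This must be below `ε`, and
  -- below 1 because `ε` only isolates `x` from the points at distance less than 1.
  obtain ⟨m, hm⟩ := exists_nat_one_div_lt (lt_min (half_pos hε) (half_pos one_pos))
  obtain ⟨n, hn⟩ := (TopologicalSpace.denseRange_denseSeq (Space d)).exists_dist_lt x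
    (Nat.one_div_pos_of_nat (n := m) (α := ℝ))
  have h : S.points ∩ smallBall d (n, m) = {x} := by
    ext y
    simp only [Set.mem_inter_iff, Set.mem_singleton_iff, smallBall, Metric.mem_ball]
    constructor
    · rintro ⟨hy, hyd⟩
      by_contra hne
      have hd : dist y x < 2 * (1 / (m + 1)) := by
        have := dist_triangle_right y x (TopologicalSpace.denseSeq (Space d) n)
        linarith
      have h1 := hm.trans_le (min_le_left _ _)
      have h2 := hm.trans_le (min_le_right _ _)
      exact hball (Metric.mem_ball.2 (show dist y x < ε by linarith))
        ⟨⟨hy, Metric.mem_ball.2 (by linarith)⟩, hne⟩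
    · rintro rfl
      exact ⟨hx, hn⟩
  have h1 : S.count (smallBall d (n, m)) = 1 := (count_eq_one_iff _ _).2 ⟨x, h⟩
  exact ⟨(n, m), h1, (Set.singleton_eq_singleton_iff.1 (h.symm.trans (pick_spec h1))).symm⟩

lemma measurableSet_smallBall (q : ℕ × ℕ) : MeasurableSet (smallBall d q) :=
  Metric.isOpen_ball.measurableSet

lemma isBounded_smallBall (q : ℕ × ℕ) : Bornology.IsBounded (smallBall d q) :=
  Metric.isBounded_ball

variable {α : Type*} [MeasurableSpace α]

/-- Quantification over tuples of points of a random configuration preserves measurability. -/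
lemma measurableSet_exists_tuple {S : α → Config d} (hS : Measurable S) {k : ℕ}
    {p : α → (Fin k → Space d) → Prop}
    (hp : MeasurableSet {q : α × (Fin k → Space d) | p q.1 q.2}) :
    MeasurableSet {a | ∃ x : Fin k → Space d, (∀ i, x i ∈ (S a).points) ∧ p a x} := by
  have h : {a | ∃ x : Fin k → Space d, (∀ i, x i ∈ (S a).points) ∧ p a x} =
      ⋃ q : Fin k → ℕ × ℕ, (⋂ i, {a | (S a).count (smallBall d (q i)) = 1}) ∩
        (fun a => (a, fun i => (S a).pick (smallBall d (q i)))) ⁻¹'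
          {q : α × (Fin k → Space d) | p q.1 q.2} := by
    ext a
    simp only [Set.mem_ofPred_eq, Set.mem_iUnion, Set.mem_inter_iff, Set.mem_iInter,
      Set.mem_preimage]
    constructor
    · rintro ⟨x, hx, hpx⟩
      choose q hq1 hq2 using fun i => exists_smallBall_pick (S a) (hx i)
      exact ⟨q, hq1, by simpa only [hq2] using hpx⟩
    · rintro ⟨q, hq1, hq2⟩
      exact ⟨_, fun i => pick_mem (hq1 i), hq2⟩
  rw [h]
  refine MeasurableSet.iUnion fun q => (MeasurableSet.iInter fun i => ?_).inter ?_
  · exact ((measurable_count (measurableSet_smallBall _) (isBounded_smallBall _)).comp hS)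
      (measurableSet_singleton 1)
  · refine hp.preimage (measurable_id.prodMk (measurable_pi_lambda _ fun i => ?_))
    exact (measurable_pick (measurableSet_smallBall _) (isBounded_smallBall _)).comp hS

lemma measurableSet_exists_mem {S : α → Config d} (hS : Measurable S) {p : α → Space d → Prop}
    (hp : MeasurableSet {q : α × Space d | p q.1 q.2}) :
    MeasurableSet {a | ∃ x ∈ (S a).points, p a x} := by
  have h := measurableSet_exists_tuple hS (k := 1) (p := fun a x => p a (x 0))
    (hp.preimage (measurable_fst.prodMk ((measurable_pi_apply 0).comp measurable_snd)))
  convert h using 3 with a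
  constructor
  · rintro ⟨x, hx, hpx⟩
    exact ⟨fun _ => x, fun _ => hx, hpx⟩
  · rintro ⟨x, hx, hpx⟩
    exact ⟨x 0, hx 0, hpx⟩

lemma measurableSet_mem {S : α → Config d} (hS : Measurable S) {f : α → Space d}
    (hf : Measurable f) : MeasurableSet {a | f a ∈ (S a).points} := by
  have h := measurableSet_exists_mem hS (p := fun a x => x = f a)
    (measurableSet_eq_fun measurable_snd (hf.comp measurable_fst))
  convert h using 3 with a
  simp

lemma measurableSet_forall_mem {S : α → Config d} (hS : Measurable S) {p : α → Space d → Prop}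
    (hp : MeasurableSet {q : α × Space d | p q.1 q.2}) :
    MeasurableSet {a | ∀ x ∈ (S a).points, p a x} := by
  have h := (measurableSet_exists_mem hS (p := fun a x => ¬ p a x) hp.compl).compl
  convert h using 1
  ext a
  simp

lemma measurableSet_adj {S R : α → Config d} (hS : Measurable S) (hR : Measurable R)
    {f g : α → Space d} (hf : Measurable f) (hg : Measurable g) :
    MeasurableSet {a | (secGraph (S a).points (R a).points).Adj (f a) (g a)} := by
  refine (measurableSet_mem hS hf).inter ((measurableSet_mem hS hg).inter
    ((measurableSet_eq_fun hf hg).compl.inter (measurableSet_forall_mem hR ?_)))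
  have hf' : Measurable fun q : α × Space d => f q.1 := hf.comp measurable_fst
  have hg' : Measurable fun q : α × Space d => g q.1 := hg.comp measurable_fst
  exact (measurableSet_le (hf'.dist hg') (measurable_snd.dist hf')).inter
    (measurableSet_le (hf'.dist hg') (measurable_snd.dist hg'))

/-- Reachability in at most `n` steps. -/
def stepReachable {V : Type*} (G : SimpleGraph V) : ℕ → V → V → Prop
  | 0, x, y => x = y
  | n + 1, x, y => ∃ z, stepReachable G n x z ∧ G.Adj z y

lemma reachable_iff_exists_stepReachable {V : Type*} (G : SimpleGraph V) (x y : V) :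
    G.Reachable x y ↔ ∃ n, stepReachable G n x y := by
  constructor
  · intro h
    exact reachable_induction h (fun y => ∃ n, stepReachable G n x y) ⟨0, rfl⟩
      fun u v _ ⟨n, hn⟩ huv => ⟨n + 1, u, hn, huv⟩
  · rintro ⟨n, hn⟩
    induction n generalizing y with
    | zero => exact hn ▸ SimpleGraph.Reachable.refl _
    | succ n ih =>
      obtain ⟨z, hz, hzy⟩ := hn
      exact (ih z hz).trans hzy.reachable

/-- By `hmem` the intermediate vertex of a walk is a point of the configuration, so the quantifier
over the uncountable space becomes a quantifier over points of a random configuration, which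
preserves measurability. -/
lemma measurableSet_stepReachable {S : α → Config d} (hS : Measurable S)
    {G : α → SimpleGraph (Space d)}
    (hG : MeasurableSet {q : α × Space d × Space d | (G q.1).Adj q.2.1 q.2.2})
    (hmem : ∀ a x y, (G a).Adj x y → x ∈ (S a).points) (n : ℕ) :
    MeasurableSet {q : α × Space d × Space d | stepReachable (G q.1) n q.2.1 q.2.2} := by
  induction n with
  | zero =>
    exact measurableSet_eq_fun (f := fun q : α × Space d × Space d => q.2.1)
      (g := fun q : α × Space d × Space d => q.2.2) (by fun_prop) (by fun_prop)
  | succ n ih =>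
    have h := measurableSet_exists_mem (α := α × Space d × Space d) (S := fun q => S q.1)
      (hS.comp measurable_fst)
      (p := fun q z => stepReachable (G q.1) n q.2.1 z ∧ (G q.1).Adj z q.2.2)
      ((ih.preimage (f := fun r : (α × Space d × Space d) × Space d => (r.1.1, r.1.2.1, r.2))
          (by fun_prop)).inter
        (hG.preimage (f := fun r : (α × Space d × Space d) × Space d => (r.1.1, r.2, r.1.2.2))
          (by fun_prop)))
    convert h using 3 with q
    constructor
    · rintro ⟨z, hz, hzy⟩
      exact ⟨z, hmem _ _ _ hzy, hz, hzy⟩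
    · rintro ⟨z, _, hz, hzy⟩
      exact ⟨z, hz, hzy⟩

lemma measurableSet_reachable {S : α → Config d} (hS : Measurable S)
    {G : α → SimpleGraph (Space d)}
    (hG : MeasurableSet {q : α × Space d × Space d | (G q.1).Adj q.2.1 q.2.2})
    (hmem : ∀ a x y, (G a).Adj x y → x ∈ (S a).points) :
    MeasurableSet {q : α × Space d × Space d | (G q.1).Reachable q.2.1 q.2.2} := by
  simp only [reachable_iff_exists_stepReachable, Set.ofPred_exists]
  exact MeasurableSet.iUnion fun n => measurableSet_stepReachable hS hG hmem n

/-- By local finiteness a cluster is infinite exactly when it is unbounded, which is a countable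
intersection of measurable conditions. -/
lemma infinite_cluster_iff (S : Config d) {G : SimpleGraph (Space d)}
    (hmem : ∀ x y, G.Adj x y → x ∈ S.points) (x : Space d) :
    (cluster G x).Infinite ↔
      ∀ n : ℕ, ∃ y ∈ S.points, (n : ℝ) < dist y x ∧ G.Reachable x y := by
  have hsub : cluster G x ⊆ insert x S.points := fun y hy =>
    reachable_induction hy (fun y => y ∈ insert x S.points) (Set.mem_insert _ _)
      fun _ _ _ _ huv => Or.inr (hmem _ _ huv.symm)
  constructor
  · intro h n
    obtain ⟨y, hy, hyn⟩ := h.exists_notMem_finite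
      (((S.finite_inter (Metric.isBounded_closedBall (x := x) (r := n)))).insert x)
    have hyx : y ≠ x := fun h => hyn (h ▸ Set.mem_insert _ _)
    have hyS : y ∈ S.points := (hsub hy).resolve_left hyx
    refine ⟨y, hyS, ?_, hy⟩
    by_contra! hle
    exact hyn (Or.inr ⟨hyS, hle⟩)
  · intro h hfin
    obtain ⟨b, hb⟩ := (hfin.image fun y => dist y x).bddAbove
    obtain ⟨n, hn⟩ := exists_nat_gt b
    obtain ⟨y, -, hy, hr⟩ := h n
    have := hb ⟨y, hr, rfl⟩
    simp only at this
    linarith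

lemma measurableSet_infinite_cluster {S : α → Config d} (hS : Measurable S)
    {G : α → SimpleGraph (Space d)}
    (hG : MeasurableSet {q : α × Space d × Space d | (G q.1).Adj q.2.1 q.2.2})
    (hmem : ∀ a x y, (G a).Adj x y → x ∈ (S a).points) :
    MeasurableSet {q : α × Space d | (cluster (G q.1) q.2).Infinite} := by
  have h : {q : α × Space d | (cluster (G q.1) q.2).Infinite} = ⋂ n : ℕ, {q : α × Space d |
      ∃ y ∈ (S q.1).points, (n : ℝ) < dist y q.2 ∧ (G q.1).Reachable q.2 y} := by
    ext q
    simp only [Set.mem_ofPred_eq, Set.mem_iInter]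
    exact infinite_cluster_iff (S q.1) (hmem q.1) q.2
  rw [h]
  refine MeasurableSet.iInter fun n => measurableSet_exists_mem (hS.comp measurable_fst) ?_
  refine (measurableSet_lt measurable_const
    (measurable_snd.dist (measurable_snd.comp measurable_fst))).inter ?_
  exact (measurableSet_reachable hS hG hmem).preimage
    (f := fun r : (α × Space d) × Space d => (r.1.1, r.1.2, r.2)) (by fun_prop)

/-- The secrecy graph of a pair of configurations. -/
abbrev pairGraph (ω : Config d × Config d) : SimpleGraph (Space d) :=
  secGraph ω.1.points ω.2.points

lemma measurableSet_pairGraph_adj :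
    MeasurableSet {q : (Config d × Config d) × Space d × Space d |
      (pairGraph q.1).Adj q.2.1 q.2.2} :=
  measurableSet_adj (by fun_prop) (by fun_prop) (by fun_prop) (by fun_prop)

lemma measurableSet_hasInfiniteClusters {U : Set (Space d)} (hU : MeasurableSet U) (k : ℕ) :
    MeasurableSet {ω : Config d × Config d | HasInfiniteClusters (pairGraph ω) U k} := by
  have hmem : ∀ (ω : Config d × Config d) x y, (pairGraph ω).Adj x y → x ∈ ω.1.points :=
    fun _ _ _ h => h.1
  have h := measurableSet_exists_tuple (α := Config d × Config d) measurable_fst (k := k)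
    (p := fun ω x => (∀ i, x i ∈ U) ∧ (∀ i, (cluster (pairGraph ω) (x i)).Infinite) ∧
      ∀ i j, i ≠ j → ¬ (pairGraph ω).Reachable (x i) (x j)) ?_
  · convert h using 3 with ω
    constructor
    · rintro ⟨x, h1, h2, h3⟩
      exact ⟨x, fun i => mem_of_infinite_cluster (h2 i), h1, h2, h3⟩
    · rintro ⟨x, -, h1, h2, h3⟩
      exact ⟨x, h1, h2, h3⟩
  · simp only [Set.ofPred_and, Set.ofPred_forall]
    refine (MeasurableSet.iInter fun i => ?_).inter ((MeasurableSet.iInter fun i => ?_).inter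
      (MeasurableSet.iInter fun i => MeasurableSet.iInter fun j => MeasurableSet.iInter fun _ => ?_))
    · exact hU.preimage (by fun_prop)
    · exact (measurableSet_infinite_cluster measurable_fst measurableSet_pairGraph_adj
        hmem).preimage (f := fun q : (Config d × Config d) × (Fin k → Space d) => (q.1, q.2 i))
        (by fun_prop)
    · exact ((measurableSet_reachable measurable_fst measurableSet_pairGraph_adj
        hmem).preimage (f := fun q : (Config d × Config d) × (Fin k → Space d) =>
          (q.1, q.2 i, q.2 j)) (by fun_prop)).compl

lemma measurableSet_isTrifurcation (n : ℕ) :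
    MeasurableSet {q : ((Config d × Config d) × (Fin (n + 1) → Space d)) × (Fin 3 → Space d) |
      IsTrifurcation (pairGraph q.1.1) n q.1.2 q.2} := by
  have hrange : ∀ {β : Type} [MeasurableSpace β]
      (f : β → ((Config d × Config d) × (Fin (n + 1) → Space d))) (g : β → Space d),
      Measurable f → Measurable g → MeasurableSet {b | g b ∈ Set.range (f b).2} := by
    intro β _ f g hf hg
    simp only [Set.mem_range, Set.ofPred_exists]
    exact MeasurableSet.iUnion fun i => measurableSet_eq_fun (by fun_prop) hg
  have hadj : ∀ {β : Type} [MeasurableSpace β] (f : β → Config d × Config d) (g h : β → Space d),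
      Measurable f → Measurable g → Measurable h →
        MeasurableSet {b | (pairGraph (f b)).Adj (g b) (h b)} :=
    fun f g h hf hg hh => measurableSet_adj (by fun_prop) (by fun_prop) hg hh
  have hdel : MeasurableSet {q : ((Config d × Config d) × (Fin (n + 1) → Space d)) ×
      Space d × Space d | (deleteVerts (pairGraph q.1.1) (Set.range q.1.2)).Adj q.2.1 q.2.2} :=
    (hadj _ _ _ (by fun_prop) (by fun_prop) (by fun_prop)).inter
      ((hrange _ _ (by fun_prop) (by fun_prop)).compl.inter
        (hrange _ _ (by fun_prop) (by fun_prop)).compl)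
  have hmem : ∀ (q : (Config d × Config d) × (Fin (n + 1) → Space d)) x y,
      (deleteVerts (pairGraph q.1) (Set.range q.2)).Adj x y → x ∈ q.1.1.points :=
    fun _ _ _ h => h.1.1
  have hS : Measurable fun q : (Config d × Config d) × (Fin (n + 1) → Space d) => q.1.1 := by
    fun_prop
  have h : {q : ((Config d × Config d) × (Fin (n + 1) → Space d)) × (Fin 3 → Space d) |
      IsTrifurcation (pairGraph q.1.1) n q.1.2 q.2} =
      {q | (∀ i : Fin n, (pairGraph q.1.1).Adj (q.1.2 i.castSucc) (q.1.2 i.succ)) ∧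
        (∀ j, ∃ i, (pairGraph q.1.1).Adj (q.1.2 i) (q.2 j)) ∧
        (∀ j, q.2 j ∉ Set.range q.1.2) ∧
        (∀ j, (cluster (deleteVerts (pairGraph q.1.1) (Set.range q.1.2)) (q.2 j)).Infinite) ∧
        ∀ i j, i ≠ j →
          ¬ (deleteVerts (pairGraph q.1.1) (Set.range q.1.2)).Reachable (q.2 i) (q.2 j)} := by
    ext q
    exact ⟨fun ⟨h1, h2, h3, h4, h5⟩ => ⟨h1, h2, h3, h4, h5⟩,
      fun ⟨h1, h2, h3, h4, h5⟩ => ⟨h1, h2, h3, h4, h5⟩⟩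
  rw [h]
  simp only [Set.ofPred_and, Set.ofPred_forall, Set.ofPred_exists]
  refine (MeasurableSet.iInter fun i => ?_).inter ((MeasurableSet.iInter fun j =>
    MeasurableSet.iUnion fun i => ?_).inter ((MeasurableSet.iInter fun j => ?_).inter
    ((MeasurableSet.iInter fun j => ?_).inter (MeasurableSet.iInter fun i =>
      MeasurableSet.iInter fun j => MeasurableSet.iInter fun _ => ?_))))
  · exact hadj _ _ _ (by fun_prop) (by fun_prop) (by fun_prop)
  · exact hadj _ _ _ (by fun_prop) (by fun_prop) (by fun_prop)
  · exact (hrange _ _ (by fun_prop) (by fun_prop)).compl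
  · exact (measurableSet_infinite_cluster hS hdel hmem).preimage
      (f := fun q : ((Config d × Config d) × (Fin (n + 1) → Space d)) × (Fin 3 → Space d) =>
        (q.1, q.2 j)) (by fun_prop)
  · exact ((measurableSet_reachable hS hdel hmem).preimage
      (f := fun q : ((Config d × Config d) × (Fin (n + 1) → Space d)) × (Fin 3 → Space d) =>
        (q.1, q.2 i, q.2 j)) (by fun_prop)).compl

/-- Every vertex involved is an endpoint of an edge; for `n = 0`, where `chain` is void, `attached`
provides one. Quantifiers over the space in `HasTrifurcation` can thus be restricted to points of
the configuration. -/
lemma IsTrifurcation.mem_points {S R : Set (Space d)} {n : ℕ} {k : Fin (n + 1) → Space d}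
    {a : Fin 3 → Space d} (h : IsTrifurcation (secGraph S R) n k a) :
    (∀ i, k i ∈ S) ∧ ∀ j, a j ∈ S := by
  refine ⟨fun i => ?_, fun j => ?_⟩
  · induction i using Fin.lastCases with
    | last =>
      cases n with
      | zero =>
        obtain ⟨i, hi⟩ := h.attached 0
        have : i = Fin.last 0 := by
          ext
          simp only [Fin.val_last]
          omega
        exact this ▸ hi.1
      | succ n => exact (h.chain (Fin.last n)).2.1
    | cast i => exact (h.chain i).1
  · obtain ⟨i, hi⟩ := h.attached j
    exact hi.2.1

lemma measurableSet_hasTrifurcation {U : Set (Space d)} (hU : MeasurableSet U) :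
    MeasurableSet {ω : Config d × Config d | HasTrifurcation (pairGraph ω) U} := by
  simp only [HasTrifurcation, Set.ofPred_exists (p := fun n (ω : Config d × Config d) =>
    ∃ (k : Fin (n + 1) → Space d) (a : Fin 3 → Space d),
      (∀ i, k i ∈ U) ∧ IsTrifurcation (pairGraph ω) n k a)]
  refine MeasurableSet.iUnion fun n => ?_
  have h := measurableSet_exists_tuple (α := Config d × Config d) measurable_fst (k := n + 1)
    (p := fun ω k => (∀ i, k i ∈ U) ∧ ∃ a : Fin 3 → Space d, (∀ j, a j ∈ ω.1.points) ∧
      IsTrifurcation (pairGraph ω) n k a) ?_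
  · convert h using 3 with ω
    constructor
    · rintro ⟨k, a, h1, h2⟩
      exact ⟨k, h2.mem_points.1, h1, a, h2.mem_points.2, h2⟩
    · rintro ⟨k, -, h1, a, -, h2⟩
      exact ⟨k, a, h1, h2⟩
  · have hk : MeasurableSet {q : (Config d × Config d) × (Fin (n + 1) → Space d) |
        ∀ i, q.2 i ∈ U} := by
      simp only [Set.ofPred_forall]
      exact MeasurableSet.iInter fun i => hU.preimage (by fun_prop)
    exact hk.inter (measurableSet_exists_tuple (by fun_prop) (measurableSet_isTrifurcation n))

end ConfigMeasurability

/-! ### The law of a Poisson process: uniqueness, independence, translation, moments -/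

section PoissonLaw

variable {d : ℕ}

/-- The points of the union of the sets `B i` lying in exactly the sets with index in `s`. -/
def atom {ι : Type*} (B : ι → Set (Space d)) (s : Finset ι) : Set (Space d) :=
  {x | (∃ i, x ∈ B i) ∧ ∀ i, x ∈ B i ↔ i ∈ s}

lemma atom_subset_iUnion {ι : Type*} (B : ι → Set (Space d)) (s : Finset ι) :
    atom B s ⊆ ⋃ i, B i := fun _ hx => Set.mem_iUnion.2 hx.1

lemma disjoint_atom {ι : Type*} (B : ι → Set (Space d)) {s t : Finset ι} (h : s ≠ t) :
    Disjoint (atom B s) (atom B t) :=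
  Set.disjoint_left.2 fun _ hs ht =>
    h (Finset.ext fun i => (hs.2 i).symm.trans (ht.2 i))

lemma measurableSet_atom {ι : Type*} [Countable ι] {B : ι → Set (Space d)}
    (hB : ∀ i, MeasurableSet (B i)) (s : Finset ι) : MeasurableSet (atom B s) := by
  have h : atom B s = (⋃ i, B i) ∩ ⋂ i, {x | x ∈ B i ↔ i ∈ s} := by
    ext x
    simp [atom]
  rw [h]
  refine (MeasurableSet.iUnion hB).inter (MeasurableSet.iInter fun i => ?_)
  by_cases hi : i ∈ s
  · simp only [hi, iff_true]
    exact hB i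
  · simp only [hi, iff_false]
    exact (hB i).compl

lemma isBounded_atom {ι : Type*} [Finite ι] {B : ι → Set (Space d)}
    (hB : ∀ i, Bornology.IsBounded (B i)) (s : Finset ι) : Bornology.IsBounded (atom B s) :=
  (Bornology.isBounded_iUnion.2 hB).subset (atom_subset_iUnion B s)

-- Overlapping sets are cut into disjoint atoms, the only sets to which the independence axiom of a
-- Poisson process applies.
open Classical in
lemma count_eq_sum_atom {ι : Type*} [Fintype ι] {B : ι → Set (Space d)}
    (hB : ∀ i, Bornology.IsBounded (B i)) (i : ι) (S : Config d) :
    S.count (B i) = ∑ s : Finset ι with i ∈ s, S.count (atom B s) := by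
  have hfin := S.finite_inter (hB i)
  rw [Config.count, Set.ncard_eq_toFinset_card _ hfin]
  rw [Finset.card_eq_sum_card_fiberwise (t := Finset.univ.filter fun s : Finset ι => i ∈ s)
    (f := fun x => Finset.univ.filter fun j => x ∈ B j)]
  · refine Finset.sum_congr rfl fun s hs => ?_
    have his : i ∈ s := (Finset.mem_filter.1 hs).2
    rw [Config.count, ← Set.ncard_coe_finset]
    congr 1
    ext x
    simp only [Finset.coe_filter, Set.Finite.mem_toFinset, Set.mem_inter_iff, Set.mem_ofPred_eq,
      atom, Finset.ext_iff, Finset.mem_filter_univ]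
    constructor
    · rintro ⟨⟨h1, h2⟩, h3⟩
      exact ⟨h1, ⟨i, h2⟩, h3⟩
    · rintro ⟨h1, -, h3⟩
      exact ⟨⟨h1, (h3 i).2 his⟩, h3⟩
  · intro x hx
    simp only [Set.Finite.coe_toFinset] at hx
    simpa using hx.2

variable {c : ℝ≥0} {ν : Measure (Config d)}

lemma IsPoissonProcess.map_law {Ω : Type*} [MeasurableSpace Ω] {μ : Measure Ω}
    {X : Ω → Config d} (h : IsPoissonProcess μ c X) : IsPoissonProcess (μ.map X) c id where
  measurable := measurable_id
  law_count B hB hb := by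
    refine ⟨(measurable_count hB hb).aemeasurable, ?_⟩
    rw [← (h.law_count B hB hb).map_eq]
    exact Measure.map_map (measurable_count hB hb) h.measurable
  indep_count n B hB hb hd := by
    have := h.indep_count n B hB hb hd
    rw [iIndepFun_iff_measure_inter_preimage_eq_mul] at this ⊢
    intro s sets hsets
    have hm : ∀ i ∈ s, MeasurableSet ((fun S : Config d => S.count (B i)) ⁻¹' sets i) :=
      fun i hi => measurable_count (hB i) (hb i) (hsets i hi)
    simp only [id]
    rw [Measure.map_apply h.measurable (Finset.measurableSet_biInter s hm),
      Finset.prod_congr rfl fun i hi => Measure.map_apply h.measurable (hm i hi)]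
    simp only [Set.preimage_iInter]
    exact this s hsets

lemma IsPoissonProcess.iIndepFun_count {κ : Type*} [Fintype κ]
    (h : IsPoissonProcess ν c id) {B : κ → Set (Space d)} (hB : ∀ i, MeasurableSet (B i))
    (hb : ∀ i, Bornology.IsBounded (B i)) (hd : Pairwise fun i j => Disjoint (B i) (B j)) :
    iIndepFun (fun i S => Config.count (B i) S) ν := by
  let e := Fintype.equivFin κ
  have := (h.indep_count (Fintype.card κ) (fun i => B (e.symm i)) (fun i => hB _) (fun i => hb _)
    (fun i j hij => hd (e.symm.injective.ne hij))).precomp e.injective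
  simpa using this

lemma IsPoissonProcess.map_count_eq_pi {κ : Type*} [Fintype κ] [IsProbabilityMeasure ν]
    (h : IsPoissonProcess ν c id) {B : κ → Set (Space d)} (hB : ∀ i, MeasurableSet (B i))
    (hb : ∀ i, Bornology.IsBounded (B i)) (hd : Pairwise fun i j => Disjoint (B i) (B j)) :
    ν.map (fun S i => Config.count (B i) S) =
      Measure.pi fun i => poissonMeasure (c * (volume (B i)).toNNReal) := by
  rw [(iIndepFun_iff_map_fun_eq_pi_map fun i => (measurable_count (hB i) (hb i)).aemeasurable).1
    (h.iIndepFun_count hB hb hd)]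
  congr 1
  ext1 i
  exact (h.law_count (B i) (hB i) (hb i)).map_eq

/-- The atom counts are independent Poisson variables with prescribed means, and the counts of the
`B i` are a fixed function `Λ` of them. These are the finite-dimensional laws used in
`IsPoissonProcess.unique`. -/
lemma IsPoissonProcess.map_count_unique {ν' : Measure (Config d)} [IsProbabilityMeasure ν]
    [IsProbabilityMeasure ν'] (h : IsPoissonProcess ν c id) (h' : IsPoissonProcess ν' c id)
    {ι : Type*} [Fintype ι] {B : ι → Set (Space d)} (hB : ∀ i, MeasurableSet (B i))
    (hb : ∀ i, Bornology.IsBounded (B i)) :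
    ν.map (fun S i => Config.count (B i) S) = ν'.map (fun S i => Config.count (B i) S) := by
  classical
  let Λ : (Finset ι → ℕ) → ι → ℕ := fun f i => ∑ s : Finset ι with i ∈ s, f s
  have hΛ : Measurable Λ := Measurable.of_discrete
  have hm : Measurable fun S (s : Finset ι) => Config.count (atom B s) S :=
    measurable_pi_lambda _ fun s => measurable_count (measurableSet_atom hB s) (isBounded_atom hb s)
  have heq : (fun (S : Config d) i => Config.count (B i) S) =
      Λ ∘ fun S (s : Finset ι) => Config.count (atom B s) S := by
    ext S i
    exact count_eq_sum_atom hb i S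
  have hd : Pairwise fun s t : Finset ι => Disjoint (atom B s) (atom B t) :=
    fun s t hst => disjoint_atom B hst
  rw [heq, ← Measure.map_map hΛ hm, ← Measure.map_map hΛ hm,
    h.map_count_eq_pi (measurableSet_atom hB) (isBounded_atom hb) hd,
    h'.map_count_eq_pi (measurableSet_atom hB) (isBounded_atom hb) hd]

/-- Bounded Borel subsets of `A`. -/
abbrev BoundedBorel (A : Set (Space d)) : Type :=
  {B : Set (Space d) // MeasurableSet B ∧ Bornology.IsBounded B ∧ B ⊆ A}

/-- All the counts of a configuration in bounded Borel subsets of `A`. -/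
noncomputable def countProcess (A : Set (Space d)) (S : Config d) (B : BoundedBorel A) : ℕ := S.count B.1

lemma measurable_countProcess (A : Set (Space d)) : Measurable (countProcess A) :=
  measurable_pi_lambda _ fun B => measurable_count B.2.1 B.2.2.1

/-- Reduces statements about a restricted configuration to its counts in bounded Borel subsets of
`A`. -/
lemma comap_restrict_le (A : Set (Space d)) (hA : MeasurableSet A) :
    MeasurableSpace.comap (Config.restrict A) inferInstance ≤
      MeasurableSpace.comap (countProcess A) inferInstance := by
  rw [← measurable_iff_comap_le]
  refine @measurable_config d (Config d) (MeasurableSpace.comap (countProcess A) inferInstance) _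
    fun B hB hb => ?_
  simp only [count_restrict]
  exact (measurable_pi_apply (⟨B ∩ A, hB.inter hA, hb.subset Set.inter_subset_left,
    Set.inter_subset_right⟩ : BoundedBorel A)).comp (comap_measurable (countProcess A))

/-- The law of a Poisson process is determined by its intensity. -/
lemma IsPoissonProcess.unique {ν' : Measure (Config d)} [IsProbabilityMeasure ν]
    [IsProbabilityMeasure ν'] (h : IsPoissonProcess ν c id) (h' : IsPoissonProcess ν' c id) :
    ν = ν' := by
  have hmap : ν.map (countProcess Set.univ) = ν'.map (countProcess Set.univ) := by
    refine IsProjectiveLimit.unique (P := fun J =>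
      (ν'.map (countProcess Set.univ)).map J.restrict) (fun J => ?_) (fun J => rfl)
    simp only
    rw [Measure.map_map (Finset.measurable_restrict J) (measurable_countProcess _),
      Measure.map_map (Finset.measurable_restrict J) (measurable_countProcess _)]
    exact h.map_count_unique h' (B := fun B : J => B.1.1) (fun B => B.1.2.1) (fun B => B.1.2.2.1)
  ext E hE
  have hE' : MeasurableSet[MeasurableSpace.comap (countProcess Set.univ) inferInstance] E := by
    refine comap_restrict_le Set.univ MeasurableSet.univ E ?_
    refine ⟨E, hE, ?_⟩
    ext S
    have : S.restrict Set.univ = S := Config.ext (by simp [Config.points_restrict])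
    simp [this]
  obtain ⟨T, hT, rfl⟩ := hE'
  rw [← Measure.map_apply (measurable_countProcess _) hT, hmap,
    Measure.map_apply (measurable_countProcess _) hT]

/-- The restrictions of a Poisson process to a set and to its complement are independent. -/
lemma IsPoissonProcess.indepFun_restrict [IsProbabilityMeasure ν] (h : IsPoissonProcess ν c id)
    {A : Set (Space d)} (hA : MeasurableSet A) :
    IndepFun (Config.restrict A) (Config.restrict Aᶜ) ν := by
  have key : IndepFun (countProcess A) (countProcess Aᶜ) ν := by
    refine IndepFun.process_indepFun_process
      (X := fun (B : BoundedBorel A) (S : Config d) => S.count B.1)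
      (Y := fun (B : BoundedBorel Aᶜ) (S : Config d) => S.count B.1)
      (fun B => measurable_count B.2.1 B.2.2.1) (fun B => measurable_count B.2.1 B.2.2.1)
      fun I J => ?_
    classical
    let BI : I → Set (Space d) := fun B => B.1.1
    let BJ : J → Set (Space d) := fun B => B.1.1
    have hBI : ∀ i, MeasurableSet (BI i) := fun i => i.1.2.1
    have hbI : ∀ i, Bornology.IsBounded (BI i) := fun i => i.1.2.2.1
    have hBJ : ∀ i, MeasurableSet (BJ i) := fun i => i.1.2.1
    have hbJ : ∀ i, Bornology.IsBounded (BJ i) := fun i => i.1.2.2.1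
    -- The atoms of the first family lie in `A` and those of the second in its complement, so all
    -- are pairwise disjoint and a single use of independence covers both families.
    let D : Finset I ⊕ Finset J → Set (Space d) := Sum.elim (atom BI) (atom BJ)
    have hDm : ∀ k, MeasurableSet (D k) := by
      rintro (s | s)
      · exact measurableSet_atom hBI s
      · exact measurableSet_atom hBJ s
    have hDb : ∀ k, Bornology.IsBounded (D k) := by
      rintro (s | s)
      · exact isBounded_atom hbI s
      · exact isBounded_atom hbJ s
    have hcross : ∀ s t, Disjoint (atom BI s) (atom BJ t) := fun s t =>
      (disjoint_compl_right (a := A)).mono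
        ((atom_subset_iUnion BI s).trans (Set.iUnion_subset fun i => i.1.2.2.2))
        ((atom_subset_iUnion BJ t).trans (Set.iUnion_subset fun i => i.1.2.2.2))
    have hDd : Pairwise fun k l => Disjoint (D k) (D l) := by
      rintro (s | s) (t | t) hst
      · exact disjoint_atom BI fun h => hst (congrArg _ h)
      · exact hcross s t
      · exact (hcross t s).symm
      · exact disjoint_atom BJ fun h => hst (congrArg _ h)
    have hind := (h.iIndepFun_count hDm hDb hDd).indepFun_finset
      (Finset.univ.map Function.Embedding.inl) (Finset.univ.map Function.Embedding.inr)
      (Finset.disjoint_map_inl_map_inr _ _) (fun k => measurable_count (hDm k) (hDb k))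
    have := hind.comp
      (φ := fun f (i : I) => ∑ s : Finset I with i ∈ s,
        f ⟨Sum.inl s, Finset.mem_map_of_mem Function.Embedding.inl (Finset.mem_univ s)⟩)
      (ψ := fun f (j : J) => ∑ s : Finset J with j ∈ s,
        f ⟨Sum.inr s, Finset.mem_map_of_mem Function.Embedding.inr (Finset.mem_univ s)⟩)
      Measurable.of_discrete Measurable.of_discrete
    convert this using 1
    · ext S i
      refine (count_eq_sum_atom hbI i S).trans ?_
      exact Finset.sum_congr (by ext; simp) fun _ _ => rfl
    · ext S j
      refine (count_eq_sum_atom hbJ j S).trans ?_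
      exact Finset.sum_congr (by ext; simp) fun _ _ => rfl
  rw [IndepFun_iff_Indep] at key ⊢
  exact indep_of_indep_of_le_left (indep_of_indep_of_le_right key (comap_restrict_le _ hA.compl))
    (comap_restrict_le _ hA)

lemma IsPoissonProcess.translate (h : IsPoissonProcess ν c id) (v : Space d) :
    IsPoissonProcess ν c (Config.translate v) where
  measurable := measurable_translate v
  law_count B hB hb := by
    have := h.law_count _ (measurable_add_const v hB) (isBounded_preimage_add hb v)
    rw [measure_preimage_add_right] at this
    simpa only [count_translate, id] using this
  indep_count n B hB hb hd := by
    have := h.indep_count n (fun i => (· + v) ⁻¹' B i) (fun i => measurable_add_const v (hB i))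
      (fun i => isBounded_preimage_add (hb i) v) (fun i j hij => (hd hij).preimage _)
    simpa only [count_translate, id] using this

lemma IsPoissonProcess.measurePreserving_translate [IsProbabilityMeasure ν]
    (h : IsPoissonProcess ν c id) (v : Space d) :
    MeasurePreserving (Config.translate v) ν ν := by
  refine ⟨measurable_translate v, ?_⟩
  have := Measure.isProbabilityMeasure_map (μ := ν) (measurable_translate v).aemeasurable
  exact (h.translate v).map_law.unique h

lemma IsPoissonProcess.measure_count_eq_zero (h : IsPoissonProcess ν c id)
    {B : Set (Space d)} (hB : MeasurableSet B) (hb : Bornology.IsBounded B) :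
    ν {S | S.count B = 0} = ENNReal.ofReal (Real.exp (-(c * volume.real B))) := by
  have := (h.law_count B hB hb).measure_eq (p := fun n => n = 0) (measurableSet_singleton 0)
  simp only [id] at this
  rw [this]
  have h0 : {x : ℕ | x = 0} = {0} := rfl
  rw [h0, poissonMeasure_singleton]
  simp [Measure.real, ENNReal.coe_toNNReal_eq_toReal]

lemma lintegral_poissonMeasure_lt_top (r : ℝ≥0) :
    ∫⁻ n, (n : ENNReal) ∂(poissonMeasure r) < ⊤ := by
  have hint : Integrable (fun n : ℕ => (n : ℝ)) (poissonMeasure r) := by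
    rw [integrable_poissonMeasure_iff]
    refine Summable.of_nonneg_of_le (fun n => by positivity) (fun n => ?_)
      ((Real.summable_pow_div_factorial (2 * r)).mul_left (Real.exp (-r)))
    have hn : (n : ℝ) ≤ 2 ^ n := by exact_mod_cast Nat.lt_two_pow_self.le
    rw [Real.norm_natCast, mul_pow, mul_div_assoc, mul_assoc]
    refine mul_le_mul_of_nonneg_left ?_ (Real.exp_pos _).le
    rw [div_mul_eq_mul_div, mul_comm]
    gcongr
  have := hint.2
  rw [hasFiniteIntegral_iff_enorm] at this
  simpa [enorm] using this

lemma IsPoissonProcess.lintegral_count_lt_top (h : IsPoissonProcess ν c id)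
    {B : Set (Space d)} (hB : MeasurableSet B) (hb : Bornology.IsBounded B) :
    ∫⁻ S, (S.count B : ENNReal) ∂ν < ⊤ := by
  have hlaw := (h.law_count B hB hb).map_eq
  simp only [id] at hlaw
  rw [← lintegral_map (f := fun n : ℕ => (n : ENNReal)) (g := fun S : Config d => S.count B)
    Measurable.of_discrete (measurable_count hB hb), hlaw]
  exact lintegral_poissonMeasure_lt_top _

end PoissonLaw

/-! ### The pair of processes: finite energy, surrounding points, zero-one law -/

section PoissonPair

variable {d : ℕ}

lemma measurableSet_of_mem_preimage_rect {α α' δ δ' : Type*} [MeasurableSpace α]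
    [MeasurableSpace α'] [MeasurableSpace δ] [MeasurableSpace δ'] {u : α → δ} {u' : α' → δ'}
    (hu : Measurable u) (hu' : Measurable u') : ∀ t ∈ Set.preimage (Prod.map u u') ''
      Set.image2 (· ×ˢ ·) {s : Set δ | MeasurableSet s} {t : Set δ' | MeasurableSet t},
      MeasurableSet t := by
  rintro _ ⟨_, ⟨s, hs, t, ht, rfl⟩, rfl⟩
  exact (hu.prodMap hu') (MeasurableSet.prod hs ht)

lemma indepFun_prodMap {α α' β β' γ γ' : Type*} [MeasurableSpace α] [MeasurableSpace α']
    [MeasurableSpace β] [MeasurableSpace β'] [MeasurableSpace γ] [MeasurableSpace γ']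
    {μ : Measure α} {μ' : Measure α'} [IsProbabilityMeasure μ] [IsProbabilityMeasure μ']
    {f : α → β} {g : α → γ} {f' : α' → β'} {g' : α' → γ'} (hf : Measurable f) (hg : Measurable g)
    (hf' : Measurable f') (hg' : Measurable g') (h : IndepFun f g μ) (h' : IndepFun f' g' μ') :
    IndepFun (Prod.map f f') (Prod.map g g') (μ.prod μ') := by
  rw [IndepFun_iff_Indep, ← generateFrom_prod, ← generateFrom_prod,
    MeasurableSpace.comap_generateFrom, MeasurableSpace.comap_generateFrom]
  refine IndepSets.indep' (measurableSet_of_mem_preimage_rect hf hf')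
    (measurableSet_of_mem_preimage_rect hg hg') (isPiSystem_prod.comap _)
    (isPiSystem_prod.comap _) ?_
  rw [IndepSets_iff]
  rintro _ _ ⟨_, ⟨s, hs, s', hs', rfl⟩, rfl⟩ ⟨_, ⟨t, ht, t', ht', rfl⟩, rfl⟩
  rw [show Prod.map f f' ⁻¹' s ×ˢ s' = (f ⁻¹' s) ×ˢ (f' ⁻¹' s') from rfl,
    show Prod.map g g' ⁻¹' t ×ˢ t' = (g ⁻¹' t) ×ˢ (g' ⁻¹' t') from rfl, Set.prod_inter_prod,
    Measure.prod_prod, Measure.prod_prod, Measure.prod_prod,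
    h.measure_inter_preimage_eq_mul s t hs ht, h'.measure_inter_preimage_eq_mul s' t' hs' ht']
  ring

variable {c c' : ℝ≥0} {ν ν' : Measure (Config d)}

/-- An event of positive probability for the configuration with the second component emptied in a
bounded set has positive probability. -/
lemma IsPoissonProcess.measure_pos_of_removal [IsProbabilityMeasure ν] [IsProbabilityMeasure ν']
    (h' : IsPoissonProcess ν' c' id)
    {B : Set (Space d)} (hB : MeasurableSet B) (hb : Bornology.IsBounded B)
    {E : Set (Config d × Config d)} (hE : MeasurableSet E)
    (hpos : (ν.prod ν') {ω | (ω.1, ω.2.restrict Bᶜ) ∈ E} ≠ 0) : (ν.prod ν') E ≠ 0 := by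
  have hr := measurable_restrict_config (d := d) hB.compl
  have hm : Measurable fun ω : Config d × Config d => (ω.1, ω.2.restrict Bᶜ) := by fun_prop
  have hF : MeasurableSet {ω : Config d × Config d | (ω.1, ω.2.restrict Bᶜ) ∈ E} := hE.preimage hm
  have hN : MeasurableSet {ω : Config d × Config d | ω.2.count B = 0} :=
    ((measurable_count hB hb).comp measurable_snd) (measurableSet_singleton 0)
  -- For each fixed first component the red points outside `B` are independent of those inside;
  -- integrating over the first component gives the product formula.
  have key : (ν.prod ν') ({ω | (ω.1, ω.2.restrict Bᶜ) ∈ E} ∩ {ω | ω.2.count B = 0}) =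
      (ν.prod ν') {ω | (ω.1, ω.2.restrict Bᶜ) ∈ E} * ν' {S | S.count B = 0} := by
    rw [Measure.prod_apply (hF.inter hN), Measure.prod_apply hF,
      ← lintegral_mul_const _ (measurable_measure_prodMk_left hF)]
    refine lintegral_congr fun S => ?_
    have hind := (h'.indepFun_restrict hB).symm.measure_inter_preimage_eq_mul
      {R : Config d | (S, R) ∈ E} {R : Config d | R.count B = 0}
      (hE.preimage measurable_prodMk_left)
      (measurable_count hB hb (measurableSet_singleton 0))
    have hc : Config.restrict B ⁻¹' {R : Config d | R.count B = 0} =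
        {R : Config d | R.count B = 0} := by
      ext R
      simp [count_restrict]
    rw [hc] at hind
    exact hind
  intro h0
  have hle : (ν.prod ν') ({ω | (ω.1, ω.2.restrict Bᶜ) ∈ E} ∩ {ω | ω.2.count B = 0}) = 0 := by
    refine measure_mono_null ?_ h0
    rintro ⟨S, R⟩ ⟨h1, h2⟩
    have : R.restrict Bᶜ = R := by
      refine Config.ext ?_
      rw [Config.points_restrict, Set.inter_eq_left]
      exact (count_eq_zero_iff R hb).1 h2
    simpa only [Set.mem_ofPred_eq, this] using h1
  rw [key, mul_eq_zero, h'.measure_count_eq_zero hB hb] at hle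
  rcases hle with hle | hle
  · exact hpos hle
  · rw [ENNReal.ofReal_eq_zero] at hle
    exact absurd (Real.exp_pos _) (not_lt.2 hle)

/-- The probability that a Poisson process has no point in a given ball of radius `r`. -/
noncomputable def emptyBallProb (d : ℕ) (c : ℝ≥0) (r : ℝ) : ENNReal :=
  ENNReal.ofReal (Real.exp (-(c * volume.real (Metric.ball (0 : Space d) r))))

lemma IsPoissonProcess.measure_empty_ball (h' : IsPoissonProcess ν' c' id) (x : Space d) (r : ℝ) :
    ν' {S | S.count (Metric.ball x r) = 0} = emptyBallProb d c' r := by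
  rw [h'.measure_count_eq_zero measurableSet_ball Metric.isBounded_ball, emptyBallProb,
    measureReal_def, Measure.addHaar_ball_center, measureReal_def]

lemma tendsto_emptyBallProb (hd : 1 ≤ d) (hc : 0 < c) :
    Filter.Tendsto (emptyBallProb d c) Filter.atTop (nhds 0) := by
  have hv : 0 < volume.real (Metric.ball (0 : Space d) 1) :=
    ENNReal.toReal_pos (Metric.measure_ball_pos volume 0 one_pos).ne'
      measure_ball_lt_top.ne
  have h1 : Filter.Tendsto (fun r : ℝ => c * (r ^ d * volume.real (Metric.ball (0 : Space d) 1)))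
      Filter.atTop Filter.atTop :=
    ((Filter.tendsto_pow_atTop (by omega)).atTop_mul_const hv).const_mul_atTop
      (NNReal.coe_pos.2 hc)
  have h2 := ENNReal.tendsto_ofReal (Real.tendsto_exp_neg_atTop_nhds_zero.comp h1)
  rw [ENNReal.ofReal_zero] at h2
  refine h2.congr' ?_
  filter_upwards [Filter.eventually_gt_atTop 0] with r hr
  have hvol : volume.real (Metric.ball (0 : Space d) r) =
      r ^ d * volume.real (Metric.ball (0 : Space d) 1) := by
    rw [measureReal_def, Measure.addHaar_ball_of_pos volume _ hr, ENNReal.toReal_mul,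
      ENNReal.toReal_ofReal (by positivity), finrank_euclideanSpace_fin, measureReal_def]
  rw [emptyBallProb, hvol]
  rfl

/-- If all coordinates were below ‖x‖/d in absolute value, the squared norm would be below ‖x‖²/d.
Hence the 2d signed axis directions suffice to surround the origin. -/
lemma exists_norm_le_coord (hd : 1 ≤ d) (x : Space d) : ∃ i, ‖x‖ ≤ d * |x i| := by
  by_contra! hcon
  have hd0 : (1 : ℝ) ≤ d := by exact_mod_cast hd
  have h1 : ∀ i, ‖x i‖ ^ 2 < (‖x‖ / d) ^ 2 := by
    intro i
    rw [Real.norm_eq_abs]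
    refine pow_lt_pow_left₀ ?_ (abs_nonneg _) two_ne_zero
    rw [lt_div_iff₀ (by linarith), mul_comm]
    exact hcon i
  have h2 := EuclideanSpace.norm_sq_eq x
  have h3 : ∑ i, ‖x i‖ ^ 2 < ∑ _i : Fin d, (‖x‖ / d) ^ 2 :=
    Finset.sum_lt_sum_of_nonempty ⟨⟨0, hd⟩, Finset.mem_univ _⟩ fun i _ => h1 i
  rw [← h2, Finset.sum_const, Finset.card_univ, Fintype.card_fin, nsmul_eq_mul, div_pow] at h3
  have h4 : (d : ℝ) * (‖x‖ ^ 2 / d ^ 2) = ‖x‖ ^ 2 / d := by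
    field_simp
  rw [h4] at h3
  exact absurd h3 (not_lt.2 (div_le_self (sq_nonneg _) hd0))

/-- The centre `t • e` contributes at least t‖x‖/d, and the deviation from it costs at most half of
that. -/
lemma inner_ge_of_mem_ball (hd : 1 ≤ d) {e x z : Space d} {t : ℝ} (ht : 0 ≤ t)
    (hx : ‖x‖ ≤ d * inner ℝ x e) (hz : z ∈ Metric.ball (t • e) (t / (2 * d))) :
    t / (2 * d) * ‖x‖ ≤ inner ℝ x z := by
  have hd0 : (1 : ℝ) ≤ d := by exact_mod_cast hd
  have h1 : inner ℝ x z = t * inner ℝ x e + inner ℝ x (z - t • e) := by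
    rw [inner_sub_right, real_inner_smul_right]
    ring
  have h2 : -(‖x‖ * (t / (2 * d))) ≤ inner ℝ x (z - t • e) := by
    have := abs_real_inner_le_norm x (z - t • e)
    rw [mem_ball_iff_norm] at hz
    have h3 := mul_le_mul_of_nonneg_left hz.le (norm_nonneg x)
    linarith [neg_abs_le (inner ℝ x (z - t • e))]
  have h3 : t * (‖x‖ / d) ≤ t * inner ℝ x e :=
    mul_le_mul_of_nonneg_left ((div_le_iff₀ (by linarith)).2 (by linarith)) ht
  have h4 : t * (‖x‖ / d) = 2 * (t / (2 * d) * ‖x‖) := by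
    field_simp
  linarith

lemma IsPoissonProcess.ae_surrounds (hd : 1 ≤ d) (hc : 0 < c') (h' : IsPoissonProcess ν' c' id) :
    ∀ᵐ R ∂ν', Surrounds R.points := by
  have hd0 : (1 : ℝ) ≤ d := by exact_mod_cast hd
  have key : ∀ (M : ℕ) (e : Space d), ∀ᵐ R ∂ν', ∃ z ∈ R.points, ∀ x : Space d,
      ‖x‖ ≤ d * inner ℝ x e → M * ‖x‖ ≤ inner ℝ x z := by
    intro M e
    have hdiv : Filter.Tendsto (fun t : ℝ => t / (2 * d)) Filter.atTop Filter.atTop :=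
      Filter.tendsto_id.atTop_div_const (by linarith)
    -- For every large `t` the failure event forces the ball around `t • e` of radius t/(2d) to be
    -- empty, so its measure is at most the limit 0 of the emptiness probabilities.
    refine le_antisymm (ge_of_tendsto ((tendsto_emptyBallProb hd hc).comp hdiv) ?_) zero_le
    filter_upwards [Filter.eventually_ge_atTop 0, hdiv.eventually_ge_atTop (M : ℝ)] with t ht htM
    simp only [Function.comp]
    rw [← h'.measure_empty_ball (t • e) (t / (2 * d))]
    refine measure_mono fun R hR => ?_
    simp only [Set.mem_ofPred_eq]
    rw [count_eq_zero_iff R Metric.isBounded_ball]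
    intro z hz hzb
    refine hR ⟨z, hz, fun x hx => ?_⟩
    exact (mul_le_mul_of_nonneg_right htM (norm_nonneg x)).trans
      (inner_ge_of_mem_ball hd ht hx hzb)
  let e : Fin d × Bool → Space d := fun p => EuclideanSpace.single p.1 (if p.2 then 1 else -1)
  have hall : ∀ᵐ R ∂ν', ∀ (M : ℕ) (p : Fin d × Bool), ∃ z ∈ R.points, ∀ x : Space d,
      ‖x‖ ≤ d * inner ℝ x (e p) → M * ‖x‖ ≤ inner ℝ x z :=
    ae_all_iff.2 fun M => ae_all_iff.2 fun p => key M (e p)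
  filter_upwards [hall] with R hR M
  choose z hzR hz using hR M
  refine ⟨Set.range z, Set.finite_range z, Set.range_subset_iff.2 hzR, fun x => ?_⟩
  obtain ⟨i, hi⟩ := exists_norm_le_coord hd x
  rcases abs_cases (x i) with ⟨h1, -⟩ | ⟨h1, -⟩
  · refine ⟨_, ⟨(i, true), rfl⟩, hz (i, true) x ?_⟩
    rw [h1] at hi
    simpa [e, EuclideanSpace.inner_single_right] using hi
  · refine ⟨_, ⟨(i, false), rfl⟩, hz (i, false) x ?_⟩
    rw [h1] at hi
    simpa [e, EuclideanSpace.inner_single_right] using hi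

/-- Restriction of both components of a pair of configurations. -/
def restrictPair (A : Set (Space d)) : Config d × Config d → Config d × Config d :=
  Prod.map (Config.restrict A) (Config.restrict A)

/-- Translation of both components of a pair of configurations. -/
def translatePair (v : Space d) : Config d × Config d → Config d × Config d :=
  Prod.map (Config.translate v) (Config.translate v)

lemma measurable_restrictPair {A : Set (Space d)} (hA : MeasurableSet A) :
    Measurable (restrictPair A) :=
  (measurable_restrict_config hA).prodMap (measurable_restrict_config hA)

lemma measurable_translatePair (v : Space d) : Measurable (translatePair v) :=
  (measurable_translate v).prodMap (measurable_translate v)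

lemma restrict_restrict (A B : Set (Space d)) (S : Config d) :
    (S.restrict B).restrict A = S.restrict (B ∩ A) :=
  Config.ext (by simp only [Config.points_restrict, Set.inter_assoc])

lemma restrict_translate (A : Set (Space d)) (v : Space d) (S : Config d) :
    (S.translate v).restrict A = (S.restrict ((· + v) ⁻¹' A)).translate v :=
  Config.ext (by simp only [Config.points_restrict, Config.points_translate,
    Set.image_inter_preimage])

/-- The events depending only on the configurations in some ball around the origin. -/
def localEvents (d : ℕ) : Set (Set (Config d × Config d)) :=
  {t | ∃ (n : ℕ) (D : Set (Config d × Config d)), MeasurableSet D ∧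
    t = restrictPair (Metric.ball 0 n) ⁻¹' D}

lemma restrictPair_preimage_ball {n m : ℕ} (h : n ≤ m) (D : Set (Config d × Config d)) :
    restrictPair (Metric.ball 0 n) ⁻¹' D =
      restrictPair (Metric.ball 0 m) ⁻¹' (restrictPair (Metric.ball 0 n) ⁻¹' D) := by
  have hsub : Metric.ball (0 : Space d) m ∩ Metric.ball 0 n = Metric.ball 0 n :=
    Set.inter_eq_right.2 (Metric.ball_subset_ball (by exact_mod_cast h))
  ext ω
  simp only [Set.mem_preimage, restrictPair, Prod.map, restrict_restrict, hsub]

lemma isSetAlgebra_localEvents : IsSetAlgebra (localEvents d) where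
  empty_mem := ⟨0, ∅, MeasurableSet.empty, rfl⟩
  compl_mem := by
    rintro _ ⟨n, D, hD, rfl⟩
    exact ⟨n, Dᶜ, hD.compl, rfl⟩
  union_mem := by
    rintro _ _ ⟨n, D, hD, rfl⟩ ⟨m, D', hD', rfl⟩
    refine ⟨max n m, restrictPair (Metric.ball 0 n) ⁻¹' D ∪ restrictPair (Metric.ball 0 m) ⁻¹' D',
      (measurable_restrictPair measurableSet_ball hD).union
        (measurable_restrictPair measurableSet_ball hD'), ?_⟩
    rw [Set.preimage_union, ← restrictPair_preimage_ball (le_max_left n m),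
      ← restrictPair_preimage_ball (le_max_right n m)]

/-- Each bounded Borel set lies in some ball around the origin, so each generating count is local.
This makes local events dense for the zero-one law. -/
lemma generateFrom_localEvents :
    (inferInstance : MeasurableSpace (Config d × Config d)) =
      MeasurableSpace.generateFrom (localEvents d) := by
  refine le_antisymm ?_ (MeasurableSpace.generateFrom_le ?_)
  · have key : ∀ g : Config d × Config d → Config d, Measurable g →
        (∀ A ω, g (restrictPair A ω) = (g ω).restrict A) →
        MeasurableSpace.comap g inferInstance ≤ MeasurableSpace.generateFrom (localEvents d) := by
      intro g hg hgr
      rw [← measurable_iff_comap_le]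
      refine @measurable_config d _ (MeasurableSpace.generateFrom (localEvents d)) g
        fun B hB hb T hT => ?_
      obtain ⟨r, hr⟩ := hb.subset_ball 0
      obtain ⟨n, hn⟩ := exists_nat_ge r
      refine MeasurableSpace.measurableSet_generateFrom ⟨n, (fun ω => (g ω).count B) ⁻¹' T,
        ((measurable_count hB hb).comp hg) hT, ?_⟩
      have hBn : B ∩ Metric.ball 0 n = B :=
        Set.inter_eq_left.2 (hr.trans (Metric.ball_subset_ball hn))
      ext ω
      simp only [Set.mem_preimage, hgr, count_restrict, hBn]
    exact sup_le (key _ measurable_fst fun _ _ => rfl) (key _ measurable_snd fun _ _ => rfl)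
  · rintro _ ⟨n, D, hD, rfl⟩
    exact measurable_restrictPair measurableSet_ball hD

lemma IsPoissonProcess.measurePreserving_translatePair [IsProbabilityMeasure ν] [IsProbabilityMeasure ν']
    (h : IsPoissonProcess ν c id)
    (h' : IsPoissonProcess ν' c' id) (v : Space d) :
    MeasurePreserving (translatePair v) (ν.prod ν') (ν.prod ν') :=
  (h.measurePreserving_translate v).prod (h'.measurePreserving_translate v)

/-- After translation by `v`, the ball shows what was in the ball of radius `n` around `-v`, which
is disjoint from the original one. -/
lemma IsPoissonProcess.indepFun_restrictPair_translate [IsProbabilityMeasure ν] [IsProbabilityMeasure ν']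
    (h : IsPoissonProcess ν c id)
    (h' : IsPoissonProcess ν' c' id) (n : ℕ) {v : Space d} (hv : 2 * n ≤ ‖v‖) :
    IndepFun (restrictPair (Metric.ball 0 n))
      (restrictPair (Metric.ball 0 n) ∘ translatePair v) (ν.prod ν') := by
  have hball : MeasurableSet (Metric.ball (0 : Space d) n) := measurableSet_ball
  have hind : IndepFun (restrictPair (Metric.ball 0 n)) (restrictPair (Metric.ball 0 n)ᶜ)
      (ν.prod ν') :=
    indepFun_prodMap (measurable_restrict_config hball) (measurable_restrict_config hball.compl)
      (measurable_restrict_config hball) (measurable_restrict_config hball.compl)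
      (h.indepFun_restrict hball) (h'.indepFun_restrict hball)
  have hpre : MeasurableSet ((· + v) ⁻¹' Metric.ball (0 : Space d) n) :=
    measurable_add_const v hball
  have hsub : (Metric.ball (0 : Space d) n)ᶜ ∩ (· + v) ⁻¹' Metric.ball (0 : Space d) n =
      (· + v) ⁻¹' Metric.ball (0 : Space d) n := by
    refine Set.inter_eq_right.2 fun x hx hx' => ?_
    simp only [Set.mem_preimage, mem_ball_zero_iff] at hx hx'
    have := norm_sub_le (x + v) x
    rw [add_sub_cancel_left] at this
    linarith
  have := hind.comp measurable_id ((measurable_translatePair v).comp (measurable_restrictPair hpre))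
  refine this.congr (ae_of_all _ fun _ => rfl) (ae_of_all _ fun ω => ?_)
  simp only [Function.comp, restrictPair, translatePair, Prod.map, restrict_translate,
    restrict_restrict, hsub]

/-- Translation invariant events have probability zero or one. -/
lemma IsPoissonProcess.measure_eq_zero_or_one_of_invariant [IsProbabilityMeasure ν] [IsProbabilityMeasure ν']
    (hd : 1 ≤ d)
    (h : IsPoissonProcess ν c id) (h' : IsPoissonProcess ν' c' id)
    {E : Set (Config d × Config d)} (hE : MeasurableSet E)
    (hinv : ∀ v, translatePair v ⁻¹' E = E) : (ν.prod ν') E = 0 ∨ (ν.prod ν') E = 1 := by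
  set P := ν.prod ν'
  have hdiff : ∀ A B : Set (Config d × Config d), MeasurableSet A → MeasurableSet B →
      |P.real A - P.real B| ≤ P.real (symmDiff A B) := by
    intro A B hA hB
    have h1 : P.real A ≤ P.real B + P.real (symmDiff A B) := by
      refine (measureReal_mono ?_).trans (measureReal_union_le B (symmDiff A B))
      intro x hx
      by_cases hxB : x ∈ B
      · exact Or.inl hxB
      · exact Or.inr (Or.inl ⟨hx, hxB⟩)
    have h2 : P.real B ≤ P.real A + P.real (symmDiff A B) := by
      refine (measureReal_mono ?_).trans (measureReal_union_le A (symmDiff A B))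
      intro x hx
      by_cases hxA : x ∈ A
      · exact Or.inl hxA
      · exact Or.inr (Or.inr ⟨hx, hxA⟩)
    rw [abs_sub_le_iff]
    constructor <;> linarith
  have hdense : P.MeasureDense (localEvents d) :=
    Measure.MeasureDense.of_generateFrom_isSetAlgebra_finite P isSetAlgebra_localEvents
      generateFrom_localEvents
  have hsq : P.real E = P.real E * P.real E := by
    refine eq_of_forall_dist_le fun ε hε => ?_
    -- With `t` within ε/4 of `E`, the intersection of `t` and its translate is within ε/2 of `E`
    -- and has probability P(t)², itself within ε/2 of P(E)². This adds up to `ε`.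
    obtain ⟨t, ⟨n, D, hD, rfl⟩, ht⟩ := hdense.approx E hE (measure_ne_top _ _) (ε / 4) (by linarith)
    set t := restrictPair (Metric.ball 0 n) ⁻¹' D
    have htm : MeasurableSet t := measurable_restrictPair measurableSet_ball hD
    have hsd : P.real (symmDiff E t) ≤ ε / 4 :=
      ENNReal.toReal_le_of_le_ofReal (by linarith) ht.le
    let v : Space d := EuclideanSpace.single ⟨0, hd⟩ (2 * n : ℝ)
    have hv : 2 * (n : ℝ) ≤ ‖v‖ := by
      simp [v]
    have hmp := h.measurePreserving_translatePair h' v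
    have htm' : MeasurableSet (translatePair v ⁻¹' t) := measurable_translatePair v htm
    have hind : P.real (t ∩ translatePair v ⁻¹' t) = P.real t * P.real t := by
      have := (h.indepFun_restrictPair_translate h' n hv).measure_inter_preimage_eq_mul D D hD hD
      rw [Set.preimage_comp] at this
      rw [measureReal_def, this, ENNReal.toReal_mul, hmp.measure_preimage htm.nullMeasurableSet]
      rfl
    have hsd' : P.real (symmDiff E (translatePair v ⁻¹' t)) ≤ ε / 4 := by
      rw [← hinv v, ← Set.preimage_symmDiff, measureReal_def,
        hmp.measure_preimage (hE.symmDiff htm).nullMeasurableSet]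
      exact hsd
    have hsd2 : P.real (symmDiff E (t ∩ translatePair v ⁻¹' t)) ≤ ε / 4 + ε / 4 := by
      refine (measureReal_mono ?_).trans ((measureReal_union_le (symmDiff E t)
        (symmDiff E (translatePair v ⁻¹' t))).trans (add_le_add hsd hsd'))
      rintro x (⟨hx, hxt⟩ | ⟨⟨hx1, hx2⟩, hxE⟩)
      · by_cases hxt1 : x ∈ t
        · exact Or.inr (Or.inl ⟨hx, fun h2 => hxt ⟨hxt1, h2⟩⟩)
        · exact Or.inl (Or.inl ⟨hx, hxt1⟩)
      · exact Or.inl (Or.inr ⟨hx1, hxE⟩)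
    have h1 := (hdiff E t hE htm).trans hsd
    have h2 := (hdiff E _ hE (htm.inter htm')).trans hsd2
    rw [hind] at h2
    have he0 : 0 ≤ P.real E := measureReal_nonneg
    have he1 : P.real E ≤ 1 := measureReal_le_one
    have ht0 : 0 ≤ P.real t := measureReal_nonneg
    have ht1 : P.real t ≤ 1 := measureReal_le_one
    rw [Real.dist_eq]
    rw [abs_le] at h1 h2 ⊢
    constructor <;> nlinarith
  have h01 : P.real E = 0 ∨ P.real E = 1 := by
    have : P.real E * (P.real E - 1) = 0 := by linarith
    rcases mul_eq_zero.1 this with h0 | h0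
    · exact Or.inl h0
    · exact Or.inr (by linarith)
  rcases h01 with h0 | h0
  · exact Or.inl ((measureReal_eq_zero_iff).1 h0)
  · right
    rw [← ofReal_measureReal (μ := P) (s := E), h0, ENNReal.ofReal_one]

end PoissonPair

/-! ### Cubes, and counting the cubes that contain a trifurcation -/

section Cells

variable {d : ℕ}

/-- The index of the cube of side `a` containing `x`. -/
noncomputable def cell (a : ℝ) (x : Space d) : Fin d → ℤ := fun i => ⌊x i / a + 1 / 2⌋

/-- The half-open cube of side `a` with index `z`. -/
noncomputable def cube (a : ℝ) (z : Fin d → ℤ) : Set (Space d) := {x | cell a x = z}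

/-- The centre of the cube of side `a` with index `z`. -/
noncomputable def cubeCenter (a : ℝ) (z : Fin d → ℤ) : Space d :=
  WithLp.toLp 2 fun i => a * z i

/-- The indices with all coordinates at most `n` in absolute value. -/
noncomputable def boxIndices (d n : ℕ) : Finset (Fin d → ℤ) := Fintype.piFinset fun _ => Finset.Icc (-n : ℤ) n

lemma card_boxIndices (n : ℕ) : (boxIndices d n).card = (2 * n + 1) ^ d := by
  rw [boxIndices, Fintype.card_piFinset_const, Int.card_Icc]
  congr 1
  omega

lemma boxIndices_mono {m n : ℕ} (h : m ≤ n) : boxIndices d m ⊆ boxIndices d n := by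
  intro z hz
  simp only [boxIndices, Fintype.mem_piFinset, Finset.mem_Icc] at hz ⊢
  intro i
  have := hz i
  omega

lemma measurable_cell (a : ℝ) : Measurable (cell a : Space d → Fin d → ℤ) :=
  measurable_pi_lambda _ fun i => Int.measurable_floor.comp (by fun_prop)

lemma measurableSet_cube (a : ℝ) (z : Fin d → ℤ) : MeasurableSet (cube a z : Set (Space d)) :=
  measurable_cell a (measurableSet_singleton z)

lemma dist_cubeCenter_le (hd : 1 ≤ d) {a : ℝ} (ha : 0 < a) {z : Fin d → ℤ} {x : Space d}
    (hx : x ∈ cube a z) : dist x (cubeCenter a z) ≤ d * a := by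
  obtain ⟨i, hi⟩ := exists_norm_le_coord hd (x - cubeCenter a z)
  rw [dist_eq_norm]
  refine hi.trans (mul_le_mul_of_nonneg_left ?_ (Nat.cast_nonneg d))
  have hz : ⌊x i / a + 1 / 2⌋ = z i := congrFun hx i
  rw [Int.floor_eq_iff] at hz
  have h1 : x i = x i / a * a := by field_simp
  have h2 : (x - cubeCenter a z) i = x i - a * z i := rfl
  rw [h2, abs_le]
  constructor <;> nlinarith

lemma isBounded_cube (hd : 1 ≤ d) {a : ℝ} (ha : 0 < a) (z : Fin d → ℤ) :
    Bornology.IsBounded (cube a z : Set (Space d)) :=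
  Metric.isBounded_closedBall.subset fun _ hx =>
    Metric.mem_closedBall.2 (dist_cubeCenter_le hd ha hx)

lemma add_cubeCenter_mem_cube {a : ℝ} (ha : 0 < a) (z : Fin d → ℤ) (x : Space d) :
    x + cubeCenter a z ∈ cube a z ↔ x ∈ cube a 0 := by
  have h : cell a (x + cubeCenter a z) = cell a x + z := by
    ext i
    have h1 : (x + cubeCenter a z) i = x i + a * z i := rfl
    have h2 : (x i + a * z i) / a + 1 / 2 = x i / a + 1 / 2 + z i := by
      field_simp
      ring
    simp only [cell, h1, h2, Int.floor_add_intCast, Pi.add_apply]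
  change cell a (x + cubeCenter a z) = z ↔ cell a x = 0
  rw [h, add_eq_right]

lemma ball_subset_cube {M : ℝ} (hM : 0 < M) :
    Metric.ball (0 : Space d) M ⊆ cube (2 * M) 0 := by
  intro x hx
  rw [mem_ball_zero_iff] at hx
  change cell (2 * M) x = 0
  ext i
  have h1 := (PiLp.norm_apply_le x i).trans_lt hx
  rw [Real.norm_eq_abs, abs_lt] at h1
  simp only [cell, Pi.zero_apply]
  rw [Int.floor_eq_iff]
  have h2 : x i = x i / (2 * M) * (2 * M) := by field_simp
  constructor <;> push_cast <;> nlinarith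

/-- In some coordinate the indices differ by at least `h + 1`, and rounding loses less than one
unit. -/
lemma le_dist_of_cell {a : ℝ} (ha : 0 < a) {m h : ℕ} {x y : Space d}
    (hx : cell a x ∈ boxIndices d m) (hy : cell a y ∉ boxIndices d (m + h)) :
    a * h ≤ dist x y := by
  simp only [boxIndices, Fintype.mem_piFinset, Finset.mem_Icc, not_forall] at hx hy
  obtain ⟨i, hi⟩ := hy
  have hxi := hx i
  simp only [cell] at hi hxi
  have hdist : |x i - y i| ≤ dist x y := by
    rw [dist_eq_norm]
    exact PiLp.norm_apply_le (x - y) i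
  refine le_trans ?_ hdist
  have hxa : x i = x i / a * a := by field_simp
  have hya : y i = y i / a * a := by field_simp
  have hx1 := Int.floor_le (x i / a + 1 / 2)
  have hx2 := Int.lt_floor_add_one (x i / a + 1 / 2)
  have hy1 := Int.floor_le (y i / a + 1 / 2)
  have hy2 := Int.lt_floor_add_one (y i / a + 1 / 2)
  have hcase : ⌊x i / a + 1 / 2⌋ + h + 1 ≤ ⌊y i / a + 1 / 2⌋ ∨
      ⌊y i / a + 1 / 2⌋ + h + 1 ≤ ⌊x i / a + 1 / 2⌋ := by
    push_cast at hi
    omega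
  rw [le_abs]
  rcases hcase with hc | hc
  · right
    have hc' : ((⌊x i / a + 1 / 2⌋ : ℤ) : ℝ) + h + 1 ≤ (⌊y i / a + 1 / 2⌋ : ℤ) := by exact_mod_cast hc
    nlinarith
  · left
    have hc' : ((⌊y i / a + 1 / 2⌋ : ℤ) : ℝ) + h + 1 ≤ (⌊x i / a + 1 / 2⌋ : ℤ) := by exact_mod_cast hc
    nlinarith

lemma HasTrifurcation.mono {V : Type*} {G : SimpleGraph V} {U U' : Set V} (h : U ⊆ U')
    (ht : HasTrifurcation G U) : HasTrifurcation G U' := by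
  obtain ⟨n, k, a, hk, hkt⟩ := ht
  exact ⟨n, k, a, fun i => h (hk i), hkt⟩

open Classical in
/-- The number of cubes of a large box containing a trifurcation is bounded by the number of points
near the boundary of the box and of points with no point of the second configuration around. -/
lemma card_trifurcation_cubes_le (hd : 1 ≤ d) {a : ℝ} (ha : 0 < a) (S R : Config d) (m h : ℕ) :
    ((boxIndices d (m + h)).filter fun z =>
        HasTrifurcation (secGraph S.points R.points) (cube a z)).card ≤
      2 * (∑ z ∈ boxIndices d (m + h) \ boxIndices d m, S.count (cube a z) +
        ∑ z ∈ boxIndices d m, S.count (cube a z) *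
          if R.count (Metric.ball (cubeCenter a z) (a * h - d * a)) = 0 then 1 else 0) := by
  set G := secGraph S.points R.points with hG
  set I := boxIndices d (m + h)
  set T := I.filter fun z => HasTrifurcation G (cube a z)
  choose n k b hk ht using fun z : T => (Finset.mem_filter.1 z.2).2
  let W : Set (Space d) := S.points ∩ {x | cell a x ∈ I}
  have hWb : Bornology.IsBounded {x : Space d | cell a x ∈ I} := by
    refine ((Bornology.isBounded_biUnion_finset I).2 fun z _ => isBounded_cube hd ha z).subset ?_
    intro x hx
    exact Set.mem_biUnion (show cell a x ∈ I from hx) (show cell a x = cell a x from rfl)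
  have hW : W.Finite := S.finite_inter hWb
  let Y : Finset (Space d) := hW.toFinset.filter fun x => ∃ y, y ∉ W ∧ G.Adj x y
  have hcard : T.card ≤ 2 * Y.card := by
    rw [← Fintype.card_coe]
    refine card_trifurcation_le G n k b ht ?_ W hW ?_ Y ?_
    · intro z z' hne
      refine Set.disjoint_left.2 ?_
      rintro _ ⟨i, rfl⟩ ⟨j, hj⟩
      have h1 : cell a (k z i) = z := hk z i
      have h2 : cell a (k z' j) = z' := hk z' j
      rw [hj] at h2
      exact hne (Subtype.ext (h1.symm.trans h2))
    · intro z i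
      refine ⟨(ht z).mem_points.1 i, ?_⟩
      have h1 : cell a (k z i) = z := hk z i
      change cell a (k z i) ∈ I
      rw [h1]
      exact (Finset.mem_filter.1 z.2).1
    · intro x hx y hy hxy
      exact Finset.mem_filter.2 ⟨hW.mem_toFinset.2 hx, y, hy, hxy⟩
  have hYW : ∀ x ∈ Y, x ∈ W := fun x hx => hW.mem_toFinset.1 (Finset.mem_filter.1 hx).1
  have hfib : ∀ z, (Y.filter fun x => cell a x = z).card ≤ S.count (cube a z) := by
    intro z
    rw [Config.count, ← Set.ncard_coe_finset]
    refine Set.ncard_le_ncard ?_ (S.finite_inter (isBounded_cube hd ha z))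
    intro x hx
    rw [Finset.coe_filter] at hx
    exact ⟨(hYW x hx.1).1, hx.2⟩
  -- A point of `Y` in the inner box has an edge of length at least `a * h`, so no red point is
  -- closer to it than that. Moving to the centre of its cube costs at most `d * a`.
  have hfib' : ∀ z ∈ boxIndices d m, (Y.filter fun x => cell a x = z).card ≤
      S.count (cube a z) *
        if R.count (Metric.ball (cubeCenter a z) (a * h - d * a)) = 0 then 1 else 0 := by
    intro z hz
    split_ifs with h0
    · rw [mul_one]
      exact hfib z
    · rw [mul_zero, Nat.le_zero, Finset.card_eq_zero, Finset.filter_eq_empty_iff]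
      intro x hx hxz
      refine h0 ((count_eq_zero_iff R Metric.isBounded_ball).2 fun w hw hwb => ?_)
      obtain ⟨y, hyW, hxy⟩ := (Finset.mem_filter.1 hx).2
      have hyI : cell a y ∉ boxIndices d (m + h) := fun hyI => hyW ⟨hxy.2.1, hyI⟩
      have h1 := le_dist_of_cell ha (hxz ▸ hz : cell a x ∈ boxIndices d m) hyI
      have h2 := (hxy.2.2.2 w hw).1
      have h3 := dist_cubeCenter_le hd ha (show x ∈ cube a z from hxz)
      have h4 := dist_triangle_right w x (cubeCenter a z)
      rw [Metric.mem_ball] at hwb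
      linarith
  refine hcard.trans (Nat.mul_le_mul_left 2 ?_)
  rw [Finset.card_eq_sum_card_fiberwise (f := cell a) (t := I) fun x hx => (hYW x hx).2,
    ← Finset.sum_sdiff (boxIndices_mono (Nat.le_add_right m h))]
  exact add_le_add (Finset.sum_le_sum fun z _ => hfib z) (Finset.sum_le_sum hfib')

end Cells

/-! ### Absence of trifurcations and uniqueness of the infinite cluster -/

section Probability

variable {d : ℕ} {c c' : ℝ≥0} {ν ν' : Measure (Config d)}

lemma IsPoissonProcess.lintegral_count_cube [IsProbabilityMeasure ν] (h : IsPoissonProcess ν c id)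
    (hd : 1 ≤ d) {a : ℝ} (ha : 0 < a) (z : Fin d → ℤ) :
    ∫⁻ S, (S.count (cube a z) : ENNReal) ∂ν = ∫⁻ S, (S.count (cube a 0) : ENNReal) ∂ν := by
  have hm : Measurable fun S : Config d => (S.count (cube a z) : ENNReal) :=
    Measurable.of_discrete.comp (measurable_count (measurableSet_cube a z) (isBounded_cube hd ha z))
  rw [← (h.measurePreserving_translate (cubeCenter a z)).lintegral_comp hm]
  refine lintegral_congr fun S => ?_
  rw [count_translate]
  congr 2
  ext x
  exact add_cubeCenter_mem_cube ha z x

lemma IsPoissonProcess.measure_hasTrifurcation_cube_ge [IsProbabilityMeasure ν]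
    [IsProbabilityMeasure ν'] (h : IsPoissonProcess ν c id) (h' : IsPoissonProcess ν' c' id)
    {M : ℝ} (hM : 0 < M) (z : Fin d → ℤ) :
    (ν.prod ν') {ω | HasTrifurcation (pairGraph ω) (Metric.ball 0 M)} ≤
      (ν.prod ν') {ω | HasTrifurcation (pairGraph ω) (cube (2 * M) z)} := by
  rw [← (h.measurePreserving_translatePair h' (cubeCenter (2 * M) z)).measure_preimage
    (measurableSet_hasTrifurcation (measurableSet_cube _ z)).nullMeasurableSet]
  refine measure_mono fun ω hω => ?_
  refine (HasTrifurcation.iso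
    (secGraphTranslate (cubeCenter (2 * M) z) ω.1.points ω.2.points) hω).mono ?_
  rintro _ ⟨x, hx, rfl⟩
  exact (add_cubeCenter_mem_cube (by linarith) z x).2 (ball_subset_cube hM hx)

/-- This is the expectation of `card_trifurcation_cubes_le`, with a collar of width `n` cubes.
Stationarity makes all cubes alike, and the product law factors the expectation in the inner box. -/
lemma IsPoissonProcess.card_mul_measure_trifurcation_le [IsProbabilityMeasure ν]
    [IsProbabilityMeasure ν'] (hd : 1 ≤ d) (h : IsPoissonProcess ν c id)
    (h' : IsPoissonProcess ν' c' id) {M : ℝ} (hM : 0 < M) (m n : ℕ) :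
    (2 * (m + n) + 1) ^ d * (ν.prod ν') {ω | HasTrifurcation (pairGraph ω) (Metric.ball 0 M)} ≤
      2 * ((((2 * (m + n) + 1) ^ d - (2 * m + 1) ^ d : ℕ) : ENNReal) *
          ∫⁻ S, (S.count (cube (2 * M) 0) : ENNReal) ∂ν +
        (2 * m + 1) ^ d * ((∫⁻ S, (S.count (cube (2 * M) 0) : ENNReal) ∂ν) *
          emptyBallProb d c' (2 * M * n - d * (2 * M)))) := by
  classical
  set a := 2 * M with ha_def
  have ha : 0 < a := by linarith
  set C := ∫⁻ S, (S.count (cube a 0) : ENNReal) ∂ν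
  set r := a * n - d * a
  have hmc : ∀ z, Measurable fun S : Config d => (S.count (cube a z) : ENNReal) := fun z =>
    Measurable.of_discrete.comp (measurable_count (measurableSet_cube a z) (isBounded_cube hd ha z))
  have hmT : ∀ z : Fin d → ℤ,
      MeasurableSet {ω : Config d × Config d | HasTrifurcation (pairGraph ω) (cube a z)} :=
    fun z => measurableSet_hasTrifurcation (measurableSet_cube a z)
  have hmR : ∀ z : Fin d → ℤ,
      MeasurableSet {R : Config d | R.count (Metric.ball (cubeCenter a z) r) = 0} :=
    fun z => measurable_count measurableSet_ball Metric.isBounded_ball (measurableSet_singleton 0)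
  have hmI : ∀ z : Fin d → ℤ, Measurable fun R : Config d =>
      (if R.count (Metric.ball (cubeCenter a z) r) = 0 then 1 else 0 : ENNReal) := fun z =>
    Measurable.ite (hmR z) measurable_const measurable_const
  have hC : ∀ z, ∫⁻ ω, (ω.1.count (cube a z) : ENNReal) ∂(ν.prod ν') = C := by
    intro z
    rw [lintegral_prod (fun ω : Config d × Config d => (ω.1.count (cube a z) : ENNReal))
      ((hmc z).comp measurable_fst).aemeasurable]
    simp only [lintegral_const, measure_univ, mul_one]
    exact h.lintegral_count_cube hd ha z
  have hCg : ∀ z, ∫⁻ ω, (ω.1.count (cube a z) : ENNReal) *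
      (if ω.2.count (Metric.ball (cubeCenter a z) r) = 0 then 1 else 0) ∂(ν.prod ν') =
        C * emptyBallProb d c' r := by
    intro z
    rw [lintegral_prod_mul (f := fun S : Config d => (S.count (cube a z) : ENNReal))
      (g := fun R : Config d => if R.count (Metric.ball (cubeCenter a z) r) = 0 then 1 else 0)
      (hmc z).aemeasurable (hmI z).aemeasurable, h.lintegral_count_cube hd ha z,
      ← h'.measure_empty_ball (cubeCenter a z) r, ← lintegral_indicator_one (hmR z)]
    congr 1
    exact lintegral_congr fun R => by simp [Set.indicator_apply]
  calc (2 * (m + n) + 1) ^ d * (ν.prod ν') {ω | HasTrifurcation (pairGraph ω) (Metric.ball 0 M)}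
      = ∑ _z ∈ boxIndices d (m + n),
          (ν.prod ν') {ω | HasTrifurcation (pairGraph ω) (Metric.ball 0 M)} := by
        rw [Finset.sum_const, card_boxIndices, nsmul_eq_mul]
        push_cast
        rfl
    _ ≤ ∑ z ∈ boxIndices d (m + n),
          (ν.prod ν') {ω | HasTrifurcation (pairGraph ω) (cube a z)} :=
        Finset.sum_le_sum fun z _ => h.measure_hasTrifurcation_cube_ge h' hM z
    _ = ∫⁻ ω, ∑ z ∈ boxIndices d (m + n),
          {ω | HasTrifurcation (pairGraph ω) (cube a z)}.indicator 1 ω ∂(ν.prod ν') := by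
        rw [lintegral_finsetSum _ fun z _ => measurable_one.indicator (hmT z)]
        exact Finset.sum_congr rfl fun z _ => (lintegral_indicator_one (hmT z)).symm
    _ ≤ ∫⁻ ω, 2 * (∑ z ∈ boxIndices d (m + n) \ boxIndices d m, (ω.1.count (cube a z) : ENNReal) +
          ∑ z ∈ boxIndices d m, (ω.1.count (cube a z) : ENNReal) *
            if ω.2.count (Metric.ball (cubeCenter a z) r) = 0 then 1 else 0) ∂(ν.prod ν') := by
        refine lintegral_mono fun ω => ?_
        have key := card_trifurcation_cubes_le hd ha ω.1 ω.2 m n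
        have key' := (Nat.cast_le (α := ENNReal)).2 key
        push_cast at key'
        refine le_trans (le_of_eq ?_) key'
        rw [Finset.card_filter]
        push_cast
        exact Finset.sum_congr rfl fun z _ => by simp [Set.indicator_apply]
    _ = 2 * ((((2 * (m + n) + 1) ^ d - (2 * m + 1) ^ d : ℕ) : ENNReal) * C +
          (2 * m + 1) ^ d * (C * emptyBallProb d c' r)) := by
        have hm1 : ∀ z ∈ boxIndices d (m + n) \ boxIndices d m,
            Measurable fun ω : Config d × Config d => (ω.1.count (cube a z) : ENNReal) :=
          fun z _ => (hmc z).comp measurable_fst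
        have hm2 : ∀ z ∈ boxIndices d m, Measurable fun ω : Config d × Config d =>
            (ω.1.count (cube a z) : ENNReal) *
              if ω.2.count (Metric.ball (cubeCenter a z) r) = 0 then 1 else 0 :=
          fun z _ => ((hmc z).comp measurable_fst).mul ((hmI z).comp measurable_snd)
        have hm12 := (Finset.measurable_fun_sum _ hm1).fun_add (Finset.measurable_fun_sum _ hm2)
        rw [lintegral_const_mul _ hm12, lintegral_add_left (Finset.measurable_fun_sum _ hm1),
          lintegral_finsetSum _ hm1, lintegral_finsetSum _ hm2]
        simp only [hC, hCg, Finset.sum_const, nsmul_eq_mul, card_boxIndices]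
        rw [Finset.card_sdiff_of_subset (boxIndices_mono (Nat.le_add_right m n)), card_boxIndices,
          card_boxIndices]
        push_cast
        rfl

/-- Trifurcations almost surely do not exist. -/
lemma IsPoissonProcess.measure_hasTrifurcation_eq_zero [IsProbabilityMeasure ν]
    [IsProbabilityMeasure ν'] (hd : 1 ≤ d) (h : IsPoissonProcess ν c id)
    (h' : IsPoissonProcess ν' c' id) (hc : 0 < c') {M : ℝ} (hM : 0 < M) :
    (ν.prod ν') {ω | HasTrifurcation (pairGraph ω) (Metric.ball 0 M)} = 0 := by
  set C := ∫⁻ S, (S.count (cube (2 * M) 0) : ENNReal) ∂ν with hCdef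
  have hC : C ≠ ⊤ :=
    (h.lintegral_count_lt_top (measurableSet_cube _ 0) (isBounded_cube hd (by linarith) 0)).ne
  set p := (ν.prod ν') {ω | HasTrifurcation (pairGraph ω) (Metric.ball 0 M)}
  have hp : p ≠ ⊤ := measure_ne_top _ _
  have hg : ∀ r, emptyBallProb d c' r ≠ ⊤ := fun r => ENNReal.ofReal_ne_top
  -- Division by the number of cubes; Bernoulli's inequality bounds the proportion of cubes in the
  -- collar by 2nd/(2(m + n) + 1).
  have hbound : ∀ n m : ℕ, p.toReal ≤ 2 * C.toReal * (2 * n * d / (2 * (m + n) + 1)) +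
      2 * C.toReal * (emptyBallProb d c' (2 * M * n - d * (2 * M))).toReal := by
    intro n m
    set g := emptyBallProb d c' (2 * M * n - d * (2 * M))
    have h1 := h.card_mul_measure_trifurcation_le hd h' hM m n
    have hle : (2 * m + 1) ^ d ≤ (2 * (m + n) + 1) ^ d := Nat.pow_le_pow_left (by omega) d
    have h2 := ENNReal.toReal_mono (by finiteness [hg (2 * M * n - d * (2 * M))]) h1
    rw [ENNReal.toReal_mul, ENNReal.toReal_mul, ENNReal.toReal_add (by finiteness)
      (by finiteness [hg (2 * M * n - d * (2 * M))]), ENNReal.toReal_mul, ENNReal.toReal_mul,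
      ENNReal.toReal_mul, ENNReal.toReal_natCast, Nat.cast_sub hle] at h2
    have e1 : ((2 * (m + n) + 1 : ENNReal) ^ d).toReal = (2 * (m + n) + 1 : ℝ) ^ d := by
      rw [ENNReal.toReal_pow]
      congr 1
    have e2 : ((2 * m + 1 : ENNReal) ^ d).toReal = (2 * m + 1 : ℝ) ^ d := by
      rw [ENNReal.toReal_pow]
      congr 1
    rw [e1, e2] at h2
    push_cast at h2
    change _ ≤ (2 : ENNReal).toReal * ((_ - _) * C.toReal + _ * (C.toReal * g.toReal)) at h2
    rw [ENNReal.toReal_ofNat] at h2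
    have hm0 : (0 : ℝ) ≤ m := Nat.cast_nonneg m
    have hn0 : (0 : ℝ) ≤ n := Nat.cast_nonneg n
    set N : ℝ := 2 * (m + n) + 1 with hN
    have hNpos : 0 < N := by positivity
    have hratio : 2 * (m : ℝ) + 1 = N * (1 + -(2 * n / N)) := by
      field_simp
      rw [hN]
      ring
    have hbern : 1 + d * (-(2 * n / N)) ≤ (1 + -(2 * n / N)) ^ d := by
      refine one_add_mul_le_pow ?_ d
      have : 2 * n / N ≤ 1 := by
        rw [div_le_one hNpos]
        linarith
      linarith
    have hNd : 0 < N ^ d := by positivity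
    have hlow : N ^ d * (1 + d * (-(2 * n / N))) ≤ (2 * (m : ℝ) + 1) ^ d := by
      rw [hratio, mul_pow]
      exact mul_le_mul_of_nonneg_left hbern hNd.le
    have hup : (2 * (m : ℝ) + 1) ^ d ≤ N ^ d := by
      refine pow_le_pow_left₀ (by positivity) ?_ d
      linarith
    have hC0 : 0 ≤ C.toReal := ENNReal.toReal_nonneg
    have hg0 : 0 ≤ g.toReal := ENNReal.toReal_nonneg
    have h3 : (N ^ d - (2 * (m : ℝ) + 1) ^ d) * C.toReal ≤
        N ^ d * (2 * n * d / N) * C.toReal := by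
      refine mul_le_mul_of_nonneg_right ?_ hC0
      have : N ^ d * (1 + d * (-(2 * n / N))) = N ^ d - N ^ d * (2 * n * d / N) := by ring
      linarith
    have h4 : (2 * (m : ℝ) + 1) ^ d * (C.toReal * g.toReal) ≤ N ^ d * (C.toReal * g.toReal) :=
      mul_le_mul_of_nonneg_right hup (mul_nonneg hC0 hg0)
    refine le_of_mul_le_mul_left ?_ hNd
    linarith
  -- The inner box grows first, with the collar width fixed, so the collar term vanishes; the width
  -- tends to infinity only afterwards.
  have hbound' : ∀ n : ℕ, p.toReal ≤
      2 * C.toReal * (emptyBallProb d c' (2 * M * n - d * (2 * M))).toReal := by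
    intro n
    have hlim : Filter.Tendsto (fun m : ℕ => 2 * C.toReal * (2 * n * d / (2 * (m + n) + 1)) +
        2 * C.toReal * (emptyBallProb d c' (2 * M * n - d * (2 * M))).toReal) Filter.atTop
        (nhds (2 * C.toReal * 0 +
          2 * C.toReal * (emptyBallProb d c' (2 * M * n - d * (2 * M))).toReal)) := by
      refine (Filter.Tendsto.const_mul _ (Filter.Tendsto.const_div_atTop ?_ _)).add_const _
      refine Filter.tendsto_atTop_mono (fun m : ℕ => ?_) tendsto_natCast_atTop_atTop
      have hm0 : (0 : ℝ) ≤ m := Nat.cast_nonneg m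
      have hn0 : (0 : ℝ) ≤ n := Nat.cast_nonneg n
      linarith
    have := ge_of_tendsto' hlim (hbound n)
    rwa [mul_zero, zero_add] at this
  have hr : Filter.Tendsto (fun n : ℕ => 2 * M * n - d * (2 * M)) Filter.atTop Filter.atTop :=
    Filter.tendsto_atTop_add_const_right _ _
      (tendsto_natCast_atTop_atTop.const_mul_atTop (by linarith))
  have hlim := ((ENNReal.tendsto_toReal ENNReal.zero_ne_top).comp
    ((tendsto_emptyBallProb hd hc).comp hr)).const_mul (2 * C.toReal)
  have hp0 : p.toReal ≤ 0 := by
    have := ge_of_tendsto' hlim hbound'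
    simpa using this
  exact (ENNReal.toReal_eq_zero_iff p).1 (le_antisymm hp0 ENNReal.toReal_nonneg) |>.resolve_right hp

lemma HasInfiniteClusters.exists_ball {k : ℕ} {G : SimpleGraph (Space d)}
    (h : HasInfiniteClusters G Set.univ k) :
    ∃ L : ℕ, HasInfiniteClusters G (Metric.ball 0 L) k := by
  obtain ⟨x, -, hinf, hsep⟩ := h
  obtain ⟨b, hb⟩ := (Set.finite_range fun i => ‖x i‖).bddAbove
  obtain ⟨L, hL⟩ := exists_nat_gt b
  exact ⟨L, x, fun i => mem_ball_zero_iff.2 ((hb ⟨i, rfl⟩).trans_lt hL), hinf, hsep⟩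

lemma translatePair_preimage_hasInfiniteClusters (k : ℕ) (v : Space d) :
    translatePair v ⁻¹' {ω | HasInfiniteClusters (pairGraph ω) Set.univ k} =
      {ω | HasInfiniteClusters (pairGraph ω) Set.univ k} := by
  have hu : ∀ {G : SimpleGraph (Space d)} {U : Set (Space d)}, HasInfiniteClusters G U k →
      HasInfiniteClusters G Set.univ k := fun ⟨x, _, h⟩ => ⟨x, fun _ => Set.mem_univ _, h⟩
  ext ω
  exact ⟨fun h => hu (h.iso (secGraphTranslate v ω.1.points ω.2.points).symm),
    fun h => hu (h.iso (secGraphTranslate v ω.1.points ω.2.points))⟩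

lemma IsPoissonProcess.exists_ball_hasInfiniteClusters [IsProbabilityMeasure ν]
    [IsProbabilityMeasure ν'] {k : ℕ}
    (hk : (ν.prod ν') {ω | HasInfiniteClusters (pairGraph ω) Set.univ k} = 1) :
    ∃ L : ℕ, (ν.prod ν') {ω | HasInfiniteClusters (pairGraph ω) (Metric.ball 0 L) k} ≠ 0 := by
  by_contra! hcon
  have := measure_mono_null (s := {ω | HasInfiniteClusters (pairGraph ω) Set.univ k})
    (fun ω hω => Set.mem_iUnion.2 (HasInfiniteClusters.exists_ball hω)) (measure_iUnion_null hcon)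
  rw [hk] at this
  exact one_ne_zero this

/-- Almost surely there are no two distinct infinite clusters. -/
lemma IsPoissonProcess.measure_two_infinite_clusters [IsProbabilityMeasure ν]
    [IsProbabilityMeasure ν'] (hd : 1 ≤ d) (h : IsPoissonProcess ν c id)
    (h' : IsPoissonProcess ν' c' id) (hc : 0 < c') :
    (ν.prod ν') {ω | HasInfiniteClusters (pairGraph ω) Set.univ 2} = 0 := by
  have h01 := fun k => h.measure_eq_zero_or_one_of_invariant hd h'
    (measurableSet_hasInfiniteClusters MeasurableSet.univ k)
    (translatePair_preimage_hasInfiniteClusters (d := d) k)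
  refine (h01 2).resolve_right fun h2 => ?_
  have hsur : ∀ᵐ ω ∂(ν.prod ν'), Surrounds ω.2.points :=
    Measure.quasiMeasurePreserving_snd.ae (h'.ae_surrounds hd hc)
  -- If three infinite clusters almost surely do not exist, merging contradicts `h2`; otherwise a
  -- trifurcation arises with positive probability.
  rcases h01 3 with h3 | h3
  · obtain ⟨L, hL⟩ := IsPoissonProcess.exists_ball_hasInfiniteClusters h2
    have hE := measurableSet_hasInfiniteClusters (d := d) MeasurableSet.univ 2
    refine h'.measure_pos_of_removal (measurableSet_ball (x := 0) (ε := 3 * L))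
      Metric.isBounded_ball hE.compl (fun h0 => hL ?_) ((prob_compl_eq_zero_iff hE).2 h2)
    have h0' : ∀ᵐ ω ∂(ν.prod ν'), ¬ (ω.1, ω.2.restrict (Metric.ball 0 (3 * L))ᶜ) ∈
        {ω : Config d × Config d | HasInfiniteClusters (pairGraph ω) Set.univ 2}ᶜ :=
      measure_eq_zero_iff_ae_notMem.1 h0
    have h3' : ∀ᵐ ω ∂(ν.prod ν'), ¬ HasInfiniteClusters (pairGraph ω) Set.univ 3 :=
      measure_eq_zero_iff_ae_notMem.1 h3
    rw [measure_eq_zero_iff_ae_notMem]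
    filter_upwards [hsur, h0', h3'] with ω hω1 hω2 hω3 hω4
    exact hω2 (not_hasInfiniteClusters_two_of_removal hd ω.1.2 hω1 L hω4 hω3)
  · obtain ⟨L, hL⟩ := IsPoissonProcess.exists_ball_hasInfiniteClusters h3
    have hex : ∃ M : ℕ, (ν.prod ν') {ω | (ω.1, ω.2.restrict (Metric.ball 0 (3 * L))ᶜ) ∈
        {ω : Config d × Config d | HasTrifurcation (pairGraph ω) (Metric.ball 0 M)}} ≠ 0 := by
      by_contra! hcon
      refine hL ?_
      have hcon' := ae_all_iff.2 fun M : ℕ => measure_eq_zero_iff_ae_notMem.1 (hcon M)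
      rw [measure_eq_zero_iff_ae_notMem]
      filter_upwards [hsur, hcon'] with ω hω1 hω2 hω3
      obtain ⟨M, hM⟩ := exists_hasTrifurcation_of_removal hd ω.1.2 hω1 L hω3
      exact hω2 M hM
    obtain ⟨M, hM⟩ := hex
    have hpos := h'.measure_pos_of_removal (measurableSet_ball (x := 0) (ε := 3 * L))
      Metric.isBounded_ball (measurableSet_hasTrifurcation (d := d) measurableSet_ball) hM
    refine hpos (measure_mono_null (fun ω hω => ?_)
      -- The radius `M` found may be 0, whereas a positive radius is required; hence `M + 1`.
      (h.measure_hasTrifurcation_eq_zero hd h' hc (M := M + 1) (by positivity)))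
    exact HasTrifurcation.mono (Metric.ball_subset_ball (by linarith)) hω

end Probability

end SecrecyGraph

/-! ### Transfer from the product law to the given probability space -/

open SecrecyGraph in
theorem mainTheorem2 (d : ℕ) (hd : 1 ≤ d) (lam : ℝ≥0) (hlam : 0 < lam)
    {Ω : Type*} [MeasurableSpace Ω] (μ : Measure Ω) [IsProbabilityMeasure μ]
    (P P' : Ω → SecrecyGraph.Config d)
    (hP : SecrecyGraph.IsPoissonProcess μ 1 P) (hP' : SecrecyGraph.IsPoissonProcess μ lam P')
    (hindep : IndepFun P P' μ) :
    (∀ᵐ ω ∂μ, SecrecyGraph.numInfiniteComponents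
        (SecrecyGraph.bidirectionalGraph (P ω) (P' ω)) = 0) ∨
      (∀ᵐ ω ∂μ, SecrecyGraph.numInfiniteComponents
        (SecrecyGraph.bidirectionalGraph (P ω) (P' ω)) = 1) := by
  have hm := hP.measurable
  have hm' := hP'.measurable
  have := Measure.isProbabilityMeasure_map (μ := μ) hm.aemeasurable
  have := Measure.isProbabilityMeasure_map (μ := μ) hm'.aemeasurable
  have hmap : μ.map (fun ω => (P ω, P' ω)) = (μ.map P).prod (μ.map P') :=
    hindep.map_prod_eq_prod_map_map hm.aemeasurable hm'.aemeasurable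
  have hpull : ∀ {p : Config d × Config d → Prop}, (∀ᵐ q ∂((μ.map P).prod (μ.map P')), p q) →
      ∀ᵐ ω ∂μ, p (P ω, P' ω) := by
    intro p hp
    rw [← hmap] at hp
    exact ae_of_ae_map (hm.prodMk hm').aemeasurable hp
  have h2 := hpull (measure_eq_zero_iff_ae_notMem.1
    (hP.map_law.measure_two_infinite_clusters hd hP'.map_law hlam))
  have hE1 := measurableSet_hasInfiniteClusters (d := d) MeasurableSet.univ 1
  rcases hP.map_law.measure_eq_zero_or_one_of_invariant hd hP'.map_law hE1
    (translatePair_preimage_hasInfiniteClusters (d := d) 1) with h1 | h1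
  · left
    filter_upwards [hpull (measure_eq_zero_iff_ae_notMem.1 h1)] with ω hω
    exact numInfiniteComponents_eq_zero _ _ hω
  · right
    have h1' := hpull (measure_eq_zero_iff_ae_notMem.1 ((prob_compl_eq_zero_iff hE1).2 h1))
    filter_upwards [h1', h2] with ω hω1 hω2
    exact numInfiniteComponents_eq_one _ _ (not_not.1 hω1) hω2
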